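/- Let $d\ge 2$, let $W\subset\mathbb{R}^d$ be a convex set with $\mathrm{vol}_d(W)=1$, and let $L\subset\mathbb{R}^d$ be a fixed two-dimensional linear plane; write $x|_L$ for the orthogonal projection onto $L$. For $t>0$ let $V=V_t$ be a Poisson point process of intensity $t$ in $W$, that is, $V=\{v_1,\dots,v_n\}$, where $n$ is Poisson distributed with parameter $t$ and, independently of $n$, the points $v_1,v_2,\dots$ are independent and uniformly distributed in $W$. Let $\delta_t>0$ be such that $\delta_t\to 0$ as $t\to\infty$ and $t\,\delta_t^d\ge c$ for some constant $c>0$ and all large $t$. Let $G$ be the geometric graph on $V$ in which two distinct points are joined by a straight edge if and only if their distance is at most $\delta_t$; let $[u,v]$ denote the segment between $u$ and $v$ if $\|u-v\|\le\delta_t$, and $[u,v]=\emptyset$ otherwise. Let $G_L$ be the projection of $G$ onto $L$, with crossing number $$\overline{\mathrm{cr}}(G_L)=\frac18\sum_{(v_1,v_2,v_3,v_4)\in V^4_{\neq}}\mathbf 1\big([v_1,v_2]|_L\cap[v_3,v_4]|_L\ne\emptyset\big),$$ where $V^4_{\neq}$ is the set of ordered $4$-tuples of pairwise distinct points of $V$.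 Then, as $t\to\infty$, $$\frac{\overline{\mathrm{cr}}(G_L)}{t^4\,\delta_t^{2d+2}}\ \longrightarrow\ \frac18\,c_d\,I^{(2)}(W,L)\qquad\text{in probability.}$$ Here $$I^{(2)}(W,L)=\int_{W|_L}\mathrm{vol}_{d-2}\big((y+L^\perp)\cap W\big)^2\,dy,$$ and $c_d$ is the constant, depending only on $d$, given by $$c_d=\int_{B_d\times 2B_2\times B_d}\mathbf 1\big([0,x|_{L_0}]\cap(y+[0,z|_{L_0}])\neq\emptyset\big)\,dz\,dy\,dx ,$$ where $L_0$ is the plane spanned by the first two coordinate vectors of $\mathbb{R}^d$, $B_d$ and $B_2$ are the closed unit balls of $\mathbb{R}^d$ and of $L_0$, and the brackets in this integral denote ordinary segments. -/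

import Mathlib

open MeasureTheory ProbabilityTheory Filter Topology

noncomputable section

namespace RandomGeometricGraph

/-- Euclidean space of dimension `d`. -/
abbrev E (d : ℕ) : Type := EuclideanSpace ℝ (Fin d)

/-- The integral over `(x, y, z)` in `B_d × 2 B_L × B_d` of the indicator that the segments
`[0, x|_L]` and `y + [0, z|_L]` meet, where `B_L` is the unit ball of `L` and `x|_L` is the
orthogonal projection of `x` onto `L`. -/
def crossingIntegral {d : ℕ} (L : Submodule ℝ (E d)) : ℝ :=
  ((volume : Measure (E d)).prod ((volume : Measure L).prod (volume : Measure (E d)))).real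
    {p : E d × L × E d |
      p.1 ∈ Metric.closedBall 0 1 ∧ p.2.1 ∈ Metric.closedBall 0 2 ∧
      p.2.2 ∈ Metric.closedBall 0 1 ∧
      (segment ℝ 0 (L.orthogonalProjectionOnto p.1) ∩
        segment ℝ p.2.1 (p.2.1 + L.orthogonalProjectionOnto p.2.2)).Nonempty}

/-- The span of the first two coordinate vectors of `ℝ^d`. -/
def coordinatePlane (d : ℕ) : Submodule ℝ (E d) :=
  Submodule.span ℝ {v | ∃ i : Fin d, i.val < 2 ∧ v = EuclideanSpace.single i 1}

/-- The constant `c_d`. The integral does not depend on the two-dimensional plane onto which one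
projects; the coordinate plane is used, so that the constant visibly depends on `d` only. -/
def crossingConstant (d : ℕ) : ℝ := crossingIntegral (coordinatePlane d)

/-- `vol_{d-2} ((y + L^⊥) ∩ W)` for a point `y` of a two-dimensional `L`. -/
def sectionVolume {d : ℕ} (W : Set (E d)) (L : Submodule ℝ (E d)) (y : L) : ℝ :=
  (volume : Measure Lᗮ).real {u : Lᗮ | (y : E d) + (u : E d) ∈ W}

/-- `I^{(2)}(W, L)`: the integral of `vol_{d-2} ((y + L^⊥) ∩ W) ^ 2` over the projection of `W`
onto `L`. -/
def secondSectionIntegral {d : ℕ} (W : Set (E d)) (L : Submodule ℝ (E d)) : ℝ :=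
  ∫ y in L.orthogonalProjectionOnto '' W, sectionVolume W L y ^ 2 ∂(volume : Measure L)

/-- The Poisson point process of intensity `t` in a convex set `W` of volume one, given by its
sampling construction: the number `N` of points is Poisson distributed with parameter `t`, the
points are the first `N` of a sequence `X` of independent uniformly distributed points of `W`, and
`N` is independent of `X`. -/
structure IsPoissonSample {d : ℕ} {Ω : Type*} [MeasurableSpace Ω] (P : Measure Ω)
    (W : Set (E d)) (t : ℝ) (N : Ω → ℕ) (X : ℕ → Ω → E d) : Prop where
  hasLaw_count : HasLaw N (poissonMeasure t.toNNReal) P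
  hasLaw_point : ∀ i, HasLaw (X i) (volume.restrict W) P
  indep_points : iIndepFun X P
  indep_count : IndepFun N (fun ω i => X i ω) P

open scoped Classical in
/-- The vertex set `{x_0, …, x_{n-1}}`. -/
def vertexSet {d : ℕ} (n : ℕ) (x : ℕ → E d) : Finset (E d) :=
  (Finset.range n).image x

open scoped Classical in
/-- `V^k_≠`: the ordered `k`-tuples of pairwise distinct elements of `V`. -/
def distinctTuples {d : ℕ} (k : ℕ) (V : Finset (E d)) : Finset (Fin k → E d) :=
  (Fintype.piFinset fun _ => V).filter fun v => Function.Injective v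

open scoped Classical in
/-- The straight edge of the geometric graph with distance parameter `r`: the segment between `u`
and `v` if their distance is at most `r`, and the empty set otherwise. -/
def edgeSegment {d : ℕ} (r : ℝ) (u v : E d) : Set (E d) :=
  if dist u v ≤ r then segment ℝ u v else ∅

open scoped Classical in
/-- The crossing number of the straight-line drawing obtained by projecting onto `L` the geometric
graph with vertex set `V` and distance parameter `r`. -/
def projectedCrossingNumber {d : ℕ} (L : Submodule ℝ (E d)) (r : ℝ) (V : Finset (E d)) : ℝ :=
  (1 / 8) * ∑ v ∈ distinctTuples 4 V,
    if ((L.orthogonalProjectionOnto '' edgeSegment r (v 0) (v 1)) ∩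
        (L.orthogonalProjectionOnto '' edgeSegment r (v 2) (v 3))).Nonempty then 1 else 0

end RandomGeometricGraph

end

noncomputable section

namespace RandomGeometricGraph

/-! The proof is a second moment argument conditional on the number `N` of points. Given `N = n`,
eight times the crossing number is a sum of crossing indicators over injective index quadruples of
`n` independent points, so its mean is `n (n-1) (n-2) (n-3) * p(r)`, where `p(r)` is the probability
that four independent points give a crossing.

Asymptotics of `p(r)`. Fix the first point, place its neighbour at scale `r`, let the third point
differ from the first by `r • y` in `L` and be arbitrary along `Lᗮ`, and place its neighbour at
scale `r`. The Jacobian is `r ^ (d + 2 + d)`. Crossing becomes a condition on the rescaled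
differences alone, while the two free `Lᗮ` components produce the squared section volume. Dominated
convergence gives `p(r) / r ^ (2 * d + 2) → c_d * I⁽²⁾(W, L)` (`tendsto_crossingProbability_div`). A
convex set of volume one is bounded with null boundary, which supplies the dominating function and
the pointwise limit.

Variance. Quadruples without a common index are uncorrelated. For `k` common indices, the remaining
points of the second quadruple are integrated out one at a time, each confined to a ball (factor of
order `r ^ d`) or to a slab over a disc in `L` (factor of order `r ^ 2`). Since `t * r ^ d` is
bounded below, every overlap contributes at most order `t ^ 7 * r ^ (4 * d + 4)` when `n ≤ 2 * t`
(`exists_variance_crossingCount_le`), smaller by a factor `t` than the square of the normalisation.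
Chebyshev's inequality for the count given `n`, and for `N` itself, concludes. -/

/-! ### Boundedness of convex sets of finite volume, and the splitting of `ℝ^d` along `L`. -/

/-- A convex set of positive finite volume is bounded. -/
theorem isBounded_of_convex_of_volume {d : ℕ} {W : Set (E d)} (hW : Convex ℝ W)
    (h0 : volume W ≠ 0) (htop : volume W ≠ ⊤) : Bornology.IsBounded W := by
  have hne : (interior W).Nonempty := by
    by_contra h
    rw [Set.not_nonempty_iff_eq_empty] at h
    refine h0 (measure_mono_null ?_ (hW.addHaar_frontier volume))
    intro x hx
    rw [frontier, h, Set.sdiff_empty]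
    exact subset_closure hx
  obtain ⟨x₀, hx₀⟩ := hne
  obtain ⟨r, hr, hball⟩ := Metric.isOpen_iff.1 isOpen_interior x₀ hx₀
  replace hball : Metric.ball x₀ r ⊆ W := hball.trans interior_subset
  set m := volume (Metric.ball (0 : E d) (r / 2)) with hm
  have hm0 : m ≠ 0 := (Metric.measure_ball_pos volume _ (by positivity)).ne'
  have hmt : m ≠ ⊤ := measure_ball_lt_top.ne
  obtain ⟨n, hn⟩ := ENNReal.exists_nat_mul_gt hm0 htop
  -- A point `w` of `W` further away than `2 * n * r` would allow `n` disjoint balls of radius `r /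
  -- 2` inside `W`, of total volume above `volume W`.
  refine (Metric.isBounded_iff_subset_closedBall x₀).2 ⟨2 * n * r, fun w hw => ?_⟩
  rw [Metric.mem_closedBall]
  by_contra! hdist
  have hpos : 0 < dist w x₀ := lt_of_le_of_lt (by positivity) hdist
  refine absurd hn (not_lt.2 ?_)
  set D := dist w x₀ with hD
  have hDn : ‖w - x₀‖ = D := by rw [hD, dist_eq_norm]
  -- The centres lie on the segment from `x₀` to `w` at spacing `r`, and all within its first half.
  -- There the cone from `w` over the ball about `x₀` still has radius at least `r / 2`.
  let c : ℕ → E d := fun k => x₀ + (k * r / D) • (w - x₀)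
  have hc : ∀ k < n, Metric.ball (c k) (r / 2) ⊆ W := by
    intro k hk y hy
    have hkn : (k : ℝ) ≤ n := by exact_mod_cast hk.le
    set s : ℝ := k * r / D with hs
    have hs0 : 0 ≤ s := by positivity
    have hs1 : s ≤ 1 / 2 := by
      rw [hs, div_le_iff₀ hpos]
      nlinarith [mul_le_mul_of_nonneg_right hkn hr.le]
    have hs2 : 0 < 1 - s := by linarith
    have hye : y = (1 - s) • (x₀ + (1 - s)⁻¹ • (y - c k)) + s • w := by
      rw [smul_add, smul_inv_smul₀ hs2.ne']
      simp only [c, ← hs]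
      module
    rw [hye]
    refine hW (hball ?_) hw hs2.le hs0 (by ring)
    rw [Metric.mem_ball, dist_eq_norm, add_sub_cancel_left, norm_smul, norm_inv, Real.norm_eq_abs,
      abs_of_pos hs2, ← dist_eq_norm]
    rw [Metric.mem_ball] at hy
    rw [inv_mul_lt_iff₀ hs2]
    nlinarith
  have hdisj : (Finset.range n : Set ℕ).PairwiseDisjoint
      fun k => Metric.ball (c k) (r / 2) := by
    intro k _ l _ hkl
    refine Metric.ball_disjoint_ball ?_
    have hcc : c k - c l = (((k : ℝ) - l) * r / D) • (w - x₀) := by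
      simp only [c]; module
    have habs : (1 : ℝ) ≤ |(k : ℝ) - l| := by
      have : (1 : ℤ) ≤ |(k : ℤ) - l| := Int.one_le_abs (sub_ne_zero.2 (by exact_mod_cast hkl))
      exact_mod_cast this
    rw [dist_eq_norm, hcc, norm_smul, hDn, Real.norm_eq_abs, abs_div, abs_mul, abs_of_pos hr,
      abs_of_pos hpos, div_mul_cancel₀ _ hpos.ne']
    nlinarith
  calc (n : ENNReal) * m = ∑ k ∈ Finset.range n, volume (Metric.ball (c k) (r / 2)) := by
        simp [Measure.addHaar_ball_center, hm]
    _ = volume (⋃ k ∈ Finset.range n, Metric.ball (c k) (r / 2)) :=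
        (measure_biUnion_finset hdisj fun _ _ => measurableSet_ball).symm
    _ ≤ volume W := measure_mono (Set.iUnion₂_subset fun k hk => hc k (Finset.mem_range.1 hk))

/-- The sum map `L × Lᗮ → ℝ^d` preserves volume. -/
theorem measurePreserving_coe_add_coe {d : ℕ} (L : Submodule ℝ (E d)) :
    MeasurePreserving (fun p : L × Lᗮ => (p.1 : E d) + (p.2 : E d)) := by
  have h := (L.orthogonalDecomposition.symm.measurePreserving).comp
    (WithLp.volume_preserving_toLp L Lᗮ)
  convert! h using 1

theorem orthogonalProjectionOnto_coe_add_coe {d : ℕ} (L : Submodule ℝ (E d)) (a : L) (u : Lᗮ) :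
    L.orthogonalProjectionOnto ((a : E d) + (u : E d)) = a := by
  rw [map_add, Submodule.orthogonalProjectionOnto_mem_subspace_eq_self,
    Submodule.orthogonalProjectionOnto_apply_of_mem_orthogonal u.2, add_zero]

theorem lintegral_eq_lintegral_coe_add_coe {d : ℕ} (L : Submodule ℝ (E d)) {g : E d → ENNReal}
    (hg : Measurable g) :
    ∫⁻ v, g v = ∫⁻ a : L, ∫⁻ u : Lᗮ, g ((a : E d) + (u : E d)) := by
  rw [← (measurePreserving_coe_add_coe L).lintegral_comp hg, Measure.volume_eq_prod,
    lintegral_prod]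
  exact (hg.comp (measurePreserving_coe_add_coe L).measurable).aemeasurable

theorem norm_snd_le {d : ℕ} (L : Submodule ℝ (E d)) (a : L) (u : Lᗮ) :
    ‖u‖ ≤ ‖(a : E d) + (u : E d)‖ := by
  have h : ‖(a : E d) + (u : E d)‖ * ‖(a : E d) + (u : E d)‖ = ‖(a : E d)‖ * ‖(a : E d)‖
      + ‖(u : E d)‖ * ‖(u : E d)‖ :=
    norm_add_sq_eq_norm_sq_add_norm_sq_of_inner_eq_zero _ _
      (Submodule.inner_right_of_mem_orthogonal a.2 u.2)
  have : ‖u‖ = ‖(u : E d)‖ := rfl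
  rw [this]
  nlinarith [norm_nonneg (a : E d), norm_nonneg (u : E d), norm_nonneg ((a : E d) + (u : E d))]

theorem norm_fst_le {d : ℕ} (L : Submodule ℝ (E d)) (a : L) (u : Lᗮ) :
    ‖a‖ ≤ ‖(a : E d) + (u : E d)‖ := by
  have h : ‖(a : E d) + (u : E d)‖ * ‖(a : E d) + (u : E d)‖ = ‖(a : E d)‖ * ‖(a : E d)‖
      + ‖(u : E d)‖ * ‖(u : E d)‖ :=
    norm_add_sq_eq_norm_sq_add_norm_sq_of_inner_eq_zero _ _
      (Submodule.inner_right_of_mem_orthogonal a.2 u.2)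
  have : ‖a‖ = ‖(a : E d)‖ := rfl
  rw [this]
  nlinarith [norm_nonneg (a : E d), norm_nonneg (u : E d), norm_nonneg ((a : E d) + (u : E d))]

/-- The volume of the part of a bounded set that projects to a given disc is at most of the order
of the area of the disc. -/
theorem exists_volume_slab_le {d : ℕ} (L : Submodule ℝ (E d)) (hL : Module.finrank ℝ L = 2)
    {U : Set (E d)} (hU : Bornology.IsBounded U) :
    ∃ C : ℝ, 0 ≤ C ∧ ∀ (a : L) (r : ℝ), 0 ≤ r →
      volume ({v | dist (L.orthogonalProjectionOnto v) a ≤ r} ∩ U) ≤ ENNReal.ofReal (C * r ^ 2) := by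
  obtain ⟨R, hR⟩ := hU.subset_closedBall 0
  have : Nontrivial L := Module.nontrivial_of_finrank_pos (R := ℝ) (by omega)
  refine ⟨(volume (Metric.ball (0 : L) 1)).toReal *
    (volume (Metric.closedBall (0 : Lᗮ) R)).toReal, by positivity, fun a r hr => ?_⟩
  have hS : {v | dist (L.orthogonalProjectionOnto v) a ≤ r} ∩ U ⊆
      {v | dist (L.orthogonalProjectionOnto v) a ≤ r} ∩ Metric.closedBall 0 R :=
    Set.inter_subset_inter_right _ hR
  have hmeas : MeasurableSet ({v : E d | dist (L.orthogonalProjectionOnto v) a ≤ r} ∩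
      Metric.closedBall 0 R) :=
    ((isClosed_le (by fun_prop) continuous_const).inter Metric.isClosed_closedBall).measurableSet
  calc _ ≤ volume ({v : E d | dist (L.orthogonalProjectionOnto v) a ≤ r} ∩
          Metric.closedBall 0 R) := measure_mono hS
    _ = volume ((fun p : L × Lᗮ => (p.1 : E d) + (p.2 : E d)) ⁻¹'
          ({v : E d | dist (L.orthogonalProjectionOnto v) a ≤ r} ∩ Metric.closedBall 0 R)) :=
        ((measurePreserving_coe_add_coe L).measure_preimage hmeas.nullMeasurableSet).symm
    _ ≤ volume (Metric.closedBall a r ×ˢ Metric.closedBall (0 : Lᗮ) R) := by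
        refine measure_mono ?_
        rintro ⟨b, u⟩ ⟨h1, h2⟩
        refine ⟨?_, ?_⟩
        · rw [Metric.mem_closedBall]
          simpa only [Set.mem_ofPred_eq, orthogonalProjectionOnto_coe_add_coe] using h1
        · rw [mem_closedBall_zero_iff] at h2 ⊢
          exact (norm_snd_le L b u).trans h2
    _ = _ := by
        rw [Measure.volume_eq_prod, Measure.prod_prod, Measure.addHaar_closedBall _ _ hr, hL,
          mul_right_comm, ENNReal.ofReal_mul (by positivity), ENNReal.ofReal_mul (by positivity),
          ENNReal.ofReal_toReal measure_ball_lt_top.ne,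
          ENNReal.ofReal_toReal measure_closedBall_lt_top.ne]
        ring

/-! ### Segments that meet -/

theorem segment_inter_segment_nonempty_iff {F : Type*} [AddCommGroup F] [Module ℝ F]
    (a b c e : F) : (segment ℝ a b ∩ segment ℝ c e).Nonempty ↔
      ∃ s ∈ Set.Icc (0 : ℝ) 1, ∃ t ∈ Set.Icc (0 : ℝ) 1, a + s • (b - a) = c + t • (e - c) := by
  simp only [segment_eq_image']
  constructor
  · rintro ⟨x, ⟨s, hs, rfl⟩, ⟨t, ht, h⟩⟩
    exact ⟨s, hs, t, ht, h.symm⟩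
  · rintro ⟨s, hs, t, ht, h⟩
    exact ⟨_, ⟨s, hs, rfl⟩, ⟨t, ht, h.symm⟩⟩

/-- The parameters of the common point range over the compact square `[0,1]²`, and projection along
a compact factor is a closed map. This is the source of all measurability of crossing events. -/
theorem isClosed_setOf_segment_inter_segment_nonempty (F : Type*) [NormedAddCommGroup F]
    [NormedSpace ℝ F] : IsClosed {q : (F × F) × F × F |
      (segment ℝ q.1.1 q.1.2 ∩ segment ℝ q.2.1 q.2.2).Nonempty} := by
  have hcl : IsClosed {p : (Set.Icc (0 : ℝ) 1 × Set.Icc (0 : ℝ) 1) × ((F × F) × F × F) |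
      p.2.1.1 + (p.1.1 : ℝ) • (p.2.1.2 - p.2.1.1) =
        p.2.2.1 + (p.1.2 : ℝ) • (p.2.2.2 - p.2.2.1)} :=
    isClosed_eq (by fun_prop) (by fun_prop)
  convert! isClosedMap_snd_of_compactSpace _ hcl using 1
  ext q
  rw [Set.mem_ofPred_eq, segment_inter_segment_nonempty_iff]
  constructor
  · rintro ⟨s, hs, t, ht, h⟩
    exact ⟨⟨(⟨s, hs⟩, ⟨t, ht⟩), q⟩, h, rfl⟩
  · rintro ⟨⟨⟨⟨s, hs⟩, ⟨t, ht⟩⟩, q'⟩, h, rfl⟩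
    exact ⟨s, hs, t, ht, h⟩

theorem segment_inter_segment_nonempty_comp_homothety {F : Type*} [AddCommGroup F] [Module ℝ F]
    {r : ℝ} (hr : r ≠ 0) (a x y z : F) :
    (segment ℝ a (a + r • x) ∩ segment ℝ (a + r • y) (a + r • y + r • z)).Nonempty ↔
      (segment ℝ 0 x ∩ segment ℝ y (y + z)).Nonempty := by
  simp only [segment_inter_segment_nonempty_iff, add_sub_cancel_left, sub_zero, zero_add]
  have key : ∀ s t : ℝ, a + s • r • x = a + r • y + t • r • z ↔ s • x = y + t • z := by
    intro s t
    rw [add_assoc, add_right_inj, smul_comm s, smul_comm t, ← smul_add,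
      (IsUnit.mk0 r hr).smul_left_cancel]
  simp only [key]

/-- The configurations of four points for which the projections of the edges between the first two
and between the last two points meet. -/
def crossingEvent {d : ℕ} (L : Submodule ℝ (E d)) (r : ℝ) : Set ((E d × E d) × (E d × E d)) :=
  {q | dist q.1.1 q.1.2 ≤ r ∧ dist q.2.1 q.2.2 ≤ r ∧
    (segment ℝ (L.orthogonalProjectionOnto q.1.1) (L.orthogonalProjectionOnto q.1.2) ∩
      segment ℝ (L.orthogonalProjectionOnto q.2.1) (L.orthogonalProjectionOnto q.2.2)).Nonempty}

theorem isClosed_crossingEvent {d : ℕ} (L : Submodule ℝ (E d)) (r : ℝ) :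
    IsClosed (crossingEvent L r) := by
  have h1 : IsClosed {q : (E d × E d) × (E d × E d) | dist q.1.1 q.1.2 ≤ r} :=
    isClosed_le (by fun_prop) continuous_const
  have h2 : IsClosed {q : (E d × E d) × (E d × E d) | dist q.2.1 q.2.2 ≤ r} :=
    isClosed_le (by fun_prop) continuous_const
  refine h1.inter (h2.inter ?_)
  exact (isClosed_setOf_segment_inter_segment_nonempty L).preimage
    (f := fun q : (E d × E d) × (E d × E d) =>
      ((L.orthogonalProjectionOnto q.1.1, L.orthogonalProjectionOnto q.1.2),
        (L.orthogonalProjectionOnto q.2.1, L.orthogonalProjectionOnto q.2.2))) (by fun_prop)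

theorem image_edgeSegment {d : ℕ} (L : Submodule ℝ (E d)) (r : ℝ) (u v : E d) :
    L.orthogonalProjectionOnto '' edgeSegment r u v =
      {y | dist u v ≤ r ∧
        y ∈ segment ℝ (L.orthogonalProjectionOnto u) (L.orthogonalProjectionOnto v)} := by
  unfold edgeSegment
  split_ifs with h
  · have := image_segment ℝ (L.orthogonalProjectionOnto : E d →ₗ[ℝ] L).toAffineMap u v
    simp only [LinearMap.coe_toAffineMap, ContinuousLinearMap.coe_coe] at this
    rw [this]
    simp [h]
  · simp [h]

theorem edgeSegment_image_inter_nonempty_iff {d : ℕ} (L : Submodule ℝ (E d)) (r : ℝ)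
    (a b c e : E d) :
    ((L.orthogonalProjectionOnto '' edgeSegment r a b) ∩
        (L.orthogonalProjectionOnto '' edgeSegment r c e)).Nonempty ↔
      ((a, b), (c, e)) ∈ crossingEvent L r := by
  simp only [image_edgeSegment, crossingEvent, Set.Nonempty, Set.mem_inter_iff, Set.mem_ofPred_eq]
  tauto

/-! ### The crossing constant -/

theorem finrank_coordinatePlane {d : ℕ} (hd : 2 ≤ d) :
    Module.finrank ℝ (coordinatePlane d) = 2 := by
  have hset : {v : E d | ∃ i : Fin d, i.val < 2 ∧ v = EuclideanSpace.single i 1} =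
      Set.range fun i : Fin 2 => EuclideanSpace.single (Fin.castLE hd i) (1 : ℝ) := by
    ext v
    constructor
    · rintro ⟨i, hi, rfl⟩
      exact ⟨⟨i.1, hi⟩, rfl⟩
    · rintro ⟨i, rfl⟩
      exact ⟨Fin.castLE hd i, i.2, rfl⟩
  have hli : LinearIndependent ℝ
      fun i : Fin 2 => EuclideanSpace.single (Fin.castLE hd i) (1 : ℝ) :=
    ((EuclideanSpace.orthonormal_single (𝕜 := ℝ) (ι := Fin d)).comp _
      (Fin.castLE_injective hd)).linearIndependent
  unfold coordinatePlane
  rw [hset, finrank_span_eq_card hli, Fintype.card_fin]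

/-- Two planes are exchanged by an isometry that commutes with the projections. -/
theorem exists_isometry_projection {d : ℕ} {L M : Submodule ℝ (E d)}
    (h : Module.finrank ℝ L = Module.finrank ℝ M) :
    ∃ (f : E d ≃ₗᵢ[ℝ] E d) (e : L ≃ₗᵢ[ℝ] M), ∀ x,
      M.orthogonalProjectionOnto (f x) = e (L.orthogonalProjectionOnto x) := by
  let e : L ≃ₗᵢ[ℝ] M := (stdOrthonormalBasis ℝ L).equiv (stdOrthonormalBasis ℝ M) (finCongr h)
  let g : L →ₗᵢ[ℝ] E d := M.subtypeₗᵢ.comp e.toLinearIsometry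
  -- An isometry between the planes extends to the whole space, and the extension then maps `Lᗮ`
  -- into `Mᗮ`.
  let f : E d ≃ₗᵢ[ℝ] E d := g.extend.toLinearIsometryEquiv rfl
  have hf : ∀ a : L, f a = (e a : E d) := fun a => g.extend_apply a
  refine ⟨f, e, fun x => ?_⟩
  have hx : x = (L.orthogonalProjectionOnto x : E d) + (x - L.orthogonalProjectionOnto x) := by abel
  have hperp : x - L.orthogonalProjectionOnto x ∈ Lᗮ := L.sub_starProjection_mem_orthogonal x
  have hperp' : f (x - L.orthogonalProjectionOnto x) ∈ Mᗮ := by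
    rw [Submodule.mem_orthogonal]
    intro m hm
    have : m = f (e.symm ⟨m, hm⟩ : L) := by rw [hf]; simp
    rw [this, LinearIsometryEquiv.inner_map_map]
    exact Submodule.inner_right_of_mem_orthogonal (e.symm ⟨m, hm⟩).2 hperp
  conv_lhs => rw [hx, map_add, map_add, hf, Submodule.orthogonalProjectionOnto_mem_subspace_eq_self,
    Submodule.orthogonalProjectionOnto_apply_of_mem_orthogonal hperp', add_zero]

/-- The set of normalized crossing configurations. -/
def crossingSet {d : ℕ} (L : Submodule ℝ (E d)) : Set (E d × L × E d) :=
  {p | p.1 ∈ Metric.closedBall 0 1 ∧ p.2.1 ∈ Metric.closedBall 0 2 ∧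
      p.2.2 ∈ Metric.closedBall 0 1 ∧
      (segment ℝ 0 (L.orthogonalProjectionOnto p.1) ∩
        segment ℝ p.2.1 (p.2.1 + L.orthogonalProjectionOnto p.2.2)).Nonempty}

theorem isClosed_crossingSet {d : ℕ} (L : Submodule ℝ (E d)) : IsClosed (crossingSet L) := by
  have h1 : IsClosed {p : E d × L × E d | p.1 ∈ Metric.closedBall 0 1} :=
    Metric.isClosed_closedBall.preimage continuous_fst
  have h2 : IsClosed {p : E d × L × E d | p.2.1 ∈ Metric.closedBall 0 2} :=
    Metric.isClosed_closedBall.preimage (continuous_fst.comp continuous_snd)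
  have h3 : IsClosed {p : E d × L × E d | p.2.2 ∈ Metric.closedBall 0 1} :=
    Metric.isClosed_closedBall.preimage (continuous_snd.comp continuous_snd)
  refine h1.inter (h2.inter (h3.inter ?_))
  exact (isClosed_setOf_segment_inter_segment_nonempty L).preimage
    (f := fun p : E d × L × E d => (((0 : L), L.orthogonalProjectionOnto p.1),
        (p.2.1, p.2.1 + L.orthogonalProjectionOnto p.2.2))) (by fun_prop)

theorem volume_crossingSet_lt_top {d : ℕ} (L : Submodule ℝ (E d)) :
    volume (crossingSet L) < ⊤ := by
  refine lt_of_le_of_lt (b := volume (Metric.closedBall (0 : E d) 1 ×ˢ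
    Metric.closedBall (0 : L) 2 ×ˢ Metric.closedBall (0 : E d) 1)) (measure_mono ?_) ?_
  · rintro ⟨x, y, z⟩ ⟨hx, hy, hz, -⟩
    exact ⟨hx, hy, hz⟩
  · rw [Measure.volume_eq_prod, Measure.prod_prod, Measure.volume_eq_prod, Measure.prod_prod]
    exact ENNReal.mul_lt_top measure_closedBall_lt_top
      (ENNReal.mul_lt_top measure_closedBall_lt_top measure_closedBall_lt_top)

/-- Rotation invariance: this lets the constant defined with the coordinate plane be used for an
arbitrary plane. -/
theorem volume_crossingSet_eq {d : ℕ} {L M : Submodule ℝ (E d)}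
    (h : Module.finrank ℝ L = Module.finrank ℝ M) :
    volume (crossingSet L) = volume (crossingSet M) := by
  obtain ⟨f, e, hfe⟩ := exists_isometry_projection h
  have hmp : MeasurePreserving (Prod.map f (Prod.map e f)) :=
    f.measurePreserving.prod (e.measurePreserving.prod f.measurePreserving)
  rw [← hmp.measure_preimage (isClosed_crossingSet M).measurableSet.nullMeasurableSet]
  congr 1
  ext ⟨x, y, z⟩
  simp only [crossingSet, Set.mem_preimage, Set.mem_ofPred_eq, Prod.map, hfe,
    mem_closedBall_zero_iff, LinearIsometryEquiv.norm_map, segment_inter_segment_nonempty_iff,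
    sub_zero, zero_add, add_sub_cancel_left, ← map_smul, ← map_add, e.injective.eq_iff]

theorem ofReal_crossingConstant {d : ℕ} (hd : 2 ≤ d) {L : Submodule ℝ (E d)}
    (hL : Module.finrank ℝ L = 2) :
    ENNReal.ofReal (crossingConstant d) = volume (crossingSet L) := by
  rw [volume_crossingSet_eq (hL.trans (finrank_coordinatePlane hd).symm)]
  exact ENNReal.ofReal_toReal (volume_crossingSet_lt_top _).ne

/-! ### The section integral -/

theorem measurable_sectionVolume {d : ℕ} (L : Submodule ℝ (E d)) {U : Set (E d)}
    (hU : MeasurableSet U) :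
    Measurable fun a : L => volume {u : Lᗮ | (a : E d) + (u : E d) ∈ U} :=
  measurable_measure_prodMk_left ((measurePreserving_coe_add_coe L).measurable hU)

theorem sectionVolume_lt_top {d : ℕ} (L : Submodule ℝ (E d)) {U : Set (E d)}
    (hU : Bornology.IsBounded U) (a : L) :
    volume {u : Lᗮ | (a : E d) + (u : E d) ∈ U} < ⊤ := by
  obtain ⟨R, hR⟩ := hU.subset_closedBall 0
  refine lt_of_le_of_lt (measure_mono ?_) (measure_closedBall_lt_top (x := (0 : Lᗮ)) (r := R))
  intro u hu
  have := hR hu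
  rw [mem_closedBall_zero_iff] at this ⊢
  exact (norm_snd_le L a u).trans this

/-- By Fubini, a null frontier meets almost every fibre in a null set. This replaces `W` by an open
set, so that measurability and pointwise limits become available. -/
theorem sectionVolume_interior_ae_eq {d : ℕ} (L : Submodule ℝ (E d)) {W : Set (E d)}
    (hW : volume (frontier W) = 0) :
    ∀ᵐ a : L, sectionVolume W L a =
      (volume {u : Lᗮ | (a : E d) + (u : E d) ∈ interior W}).toReal := by
  have h := (measurePreserving_coe_add_coe L).quasiMeasurePreserving.ae
    (interior_ae_eq_of_null_frontier hW).mem_iff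
  filter_upwards [Measure.ae_ae_of_ae_prod h] with a ha
  refine congrArg ENNReal.toReal (measure_congr ?_)
  filter_upwards [ha] with u hu
  exact propext hu.symm

theorem secondSectionIntegral_eq_toReal {d : ℕ} (L : Submodule ℝ (E d)) {W : Set (E d)}
    (hb : Bornology.IsBounded W) (hW : volume (frontier W) = 0) :
    secondSectionIntegral W L =
      (∫⁻ a : L, volume {u : Lᗮ | (a : E d) + (u : E d) ∈ interior W} ^ 2).toReal := by
  unfold secondSectionIntegral
  -- Sections vanish off the projection of `W`, so the domain of integration can be enlarged to all
  -- of `L` without knowing that the projection is measurable.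
  rw [setIntegral_eq_integral_of_forall_compl_eq_zero, ← integral_toReal]
  · refine integral_congr_ae ?_
    filter_upwards [sectionVolume_interior_ae_eq L hW] with a ha
    rw [ha, ENNReal.toReal_pow]
  · exact ((measurable_sectionVolume L measurableSet_interior).pow_const 2).aemeasurable
  · exact ae_of_all _ fun a =>
      ENNReal.pow_lt_top (sectionVolume_lt_top L (hb.subset interior_subset) a)
  · intro a ha
    have : {u : Lᗮ | (a : E d) + (u : E d) ∈ W} = ∅ := by
      rw [Set.eq_empty_iff_forall_notMem]
      intro u hu
      exact ha ⟨_, hu, orthogonalProjectionOnto_coe_add_coe L a u⟩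
    simp [sectionVolume, this]

theorem lintegral_sectionVolume_sq_lt_top {d : ℕ} (L : Submodule ℝ (E d)) {U : Set (E d)}
    (hb : Bornology.IsBounded U) :
    ∫⁻ a : L, volume {u : Lᗮ | (a : E d) + (u : E d) ∈ U} ^ 2 < ⊤ := by
  obtain ⟨R, hR⟩ := hb.subset_closedBall 0
  calc ∫⁻ a : L, volume {u : Lᗮ | (a : E d) + (u : E d) ∈ U} ^ 2
      ≤ ∫⁻ a : L, (Metric.closedBall (0 : L) R).indicator
          (fun _ => volume (Metric.closedBall (0 : Lᗮ) R) ^ 2) a := by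
        refine lintegral_mono fun a => ?_
        by_cases ha : a ∈ Metric.closedBall (0 : L) R
        · rw [Set.indicator_of_mem ha]
          refine pow_le_pow_left' (measure_mono fun u hu => ?_) 2
          have := hR hu
          rw [mem_closedBall_zero_iff] at this ⊢
          exact (norm_snd_le L a u).trans this
        · have : {u : Lᗮ | (a : E d) + (u : E d) ∈ U} = ∅ := by
            rw [Set.eq_empty_iff_forall_notMem]
            intro u hu
            refine ha ?_
            have := hR hu
            rw [mem_closedBall_zero_iff] at this ⊢
            exact (norm_fst_le L a u).trans this
          simp [this]
    _ < ⊤ := by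
        rw [lintegral_indicator_const Metric.isClosed_closedBall.measurableSet]
        exact ENNReal.mul_lt_top (ENNReal.pow_lt_top measure_closedBall_lt_top)
          measure_closedBall_lt_top

/-! ### The probability of a crossing for small distance parameters -/

theorem lintegral_eq_mul_lintegral_add_smul {F : Type*} [NormedAddCommGroup F]
    [InnerProductSpace ℝ F] [FiniteDimensional ℝ F] [MeasurableSpace F] [BorelSpace F]
    {g : F → ENNReal} (hg : Measurable g) (a : F) {r : ℝ} (hr : 0 < r) :
    ∫⁻ v, g v = ENNReal.ofReal (r ^ Module.finrank ℝ F) * ∫⁻ x, g (a + r • x) := by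
  have h1 : ∫⁻ x, g (a + r • x) = ∫⁻ y, g (a + y) ∂(Measure.map (fun x : F => r • x) volume) :=
    (lintegral_map (hg.comp (measurable_const_add a)) (measurable_const_smul r)).symm
  rw [h1, Measure.map_addHaar_smul _ hr.ne', lintegral_smul_measure, smul_eq_mul, ← mul_assoc,
    lintegral_add_left_eq_self, ← ENNReal.ofReal_mul (by positivity),
    abs_of_pos (by positivity), mul_inv_cancel₀ (by positivity), ENNReal.ofReal_one, one_mul]

/-- The four points in terms of rescaled coordinates. -/
def rescaledPoints {d : ℕ} (L : Submodule ℝ (E d)) (r : ℝ)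
    (p : (L × Lᗮ) × E d × (L × Lᗮ) × E d) : (E d × E d) × (E d × E d) :=
  (((p.1.1 : E d) + p.1.2, (p.1.1 : E d) + p.1.2 + r • p.2.1),
    (((p.1.1 + r • p.2.2.1.1 : L) : E d) + p.2.2.1.2,
      ((p.1.1 + r • p.2.2.1.1 : L) : E d) + p.2.2.1.2 + r • p.2.2.2))

theorem continuous_rescaledPoints {d : ℕ} (L : Submodule ℝ (E d)) (r : ℝ) :
    Continuous (rescaledPoints L r) := by
  unfold rescaledPoints
  fun_prop

theorem lintegral_nested {d : ℕ} (L : Submodule ℝ (E d))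
    {G : (L × Lᗮ) × E d × (L × Lᗮ) × E d → ENNReal} (hG : Measurable G) :
    ∫⁻ p, G p = ∫⁻ a : L, ∫⁻ u : Lᗮ, ∫⁻ x : E d, ∫⁻ y : L, ∫⁻ w : Lᗮ, ∫⁻ z : E d,
      G ((a, u), x, (y, w), z) := by
  rw [Measure.volume_eq_prod, lintegral_prod _ hG.aemeasurable, Measure.volume_eq_prod,
    lintegral_prod _ hG.lintegral_prod_right'.aemeasurable]
  refine lintegral_congr fun a => lintegral_congr fun u => ?_
  have h1 : Measurable fun q : E d × (L × Lᗮ) × E d => G ((a, u), q) := by fun_prop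
  rw [Measure.volume_eq_prod, lintegral_prod _ h1.aemeasurable]
  refine lintegral_congr fun x => ?_
  have h2 : Measurable fun q : (L × Lᗮ) × E d => G ((a, u), x, q) := by fun_prop
  rw [Measure.volume_eq_prod, lintegral_prod _ h2.aemeasurable, Measure.volume_eq_prod,
    lintegral_prod _ h2.lintegral_prod_right'.aemeasurable]

/-- Three substitutions give the power: `r ^ d` for the second point, `r ^ 2` for the `L` component
of the third, `r ^ d` for the fourth. The first point and the `Lᗮ` component of the third stay
unscaled. -/
theorem lintegral_eq_mul_lintegral_rescaledPoints {d : ℕ} (L : Submodule ℝ (E d))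
    (hL : Module.finrank ℝ L = 2) {r : ℝ} (hr : 0 < r)
    {g : (E d × E d) × (E d × E d) → ENNReal} (hg : Measurable g) :
    ∫⁻ q, g q = ENNReal.ofReal (r ^ (2 * d + 2)) * ∫⁻ p, g (rescaledPoints L r p) := by
  have hE : Module.finrank ℝ (E d) = d := by simp
  have hG : Measurable fun p => g (rescaledPoints L r p) :=
    hg.comp (continuous_rescaledPoints L r).measurable
  rw [lintegral_nested L hG,
    Measure.volume_eq_prod, lintegral_prod _ hg.aemeasurable, Measure.volume_eq_prod,
    lintegral_prod _ hg.lintegral_prod_right'.aemeasurable,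
    lintegral_eq_lintegral_coe_add_coe L
      (Measurable.lintegral_prod_right' (ν := volume)
        (hg.lintegral_prod_right' (ν := volume.prod volume))),
    ← lintegral_const_mul' _ _ ENNReal.ofReal_ne_top]
  refine lintegral_congr fun a => ?_
  rw [← lintegral_const_mul' _ _ ENNReal.ofReal_ne_top]
  refine lintegral_congr fun u => ?_
  have h2 : Measurable fun v : E d =>
      ∫⁻ q, g (((a : E d) + u, v), q) ∂((volume : Measure (E d)).prod volume) :=
    (hg.lintegral_prod_right' (ν := volume.prod volume)).comp measurable_prodMk_left
  rw [lintegral_eq_mul_lintegral_add_smul h2 ((a : E d) + u) hr, hE,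
    show 2 * d + 2 = d + (2 + d) by ring, pow_add, ENNReal.ofReal_mul (by positivity), mul_assoc]
  congr 1
  rw [← lintegral_const_mul' _ _ ENNReal.ofReal_ne_top]
  refine lintegral_congr fun x => ?_
  have h3 : Measurable fun q : E d × E d =>
      g (((a : E d) + u, (a : E d) + u + r • x), q) := by fun_prop
  simp only [rescaledPoints]
  rw [lintegral_prod _ h3.aemeasurable,
    lintegral_eq_lintegral_coe_add_coe L h3.lintegral_prod_right',
    lintegral_eq_mul_lintegral_add_smul (a := a) (hr := hr), hL, pow_add,
    ENNReal.ofReal_mul (by positivity), mul_assoc]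
  swap
  · have := h3.lintegral_prod_right' (ν := volume)
    refine Measurable.lintegral_prod_right' (f := fun q : L × Lᗮ => ∫⁻ y,
      g (((a : E d) + u, (a : E d) + u + r • x), (q.1 : E d) + q.2, y)) ?_
    exact this.comp (measurePreserving_coe_add_coe L).measurable
  congr 1
  rw [← lintegral_const_mul' _ _ ENNReal.ofReal_ne_top]
  refine lintegral_congr fun y => ?_
  rw [← lintegral_const_mul' _ _ ENNReal.ofReal_ne_top]
  refine lintegral_congr fun w => ?_
  rw [lintegral_eq_mul_lintegral_add_smul (a := ((a + r • y : L) : E d) + w) (hr := hr)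
    (by fun_prop), hE]

/-- Crossings are invariant under translation and dilation, so `a`, `u`, `w` and `r` drop out. The
bound `2` on `y` is automatic: at a common point, `y` is a difference of two vectors of norm at most
`1`. -/
theorem rescaledPoints_mem_crossingEvent_iff {d : ℕ} (L : Submodule ℝ (E d)) {r : ℝ} (hr : 0 < r)
    (p : (L × Lᗮ) × E d × (L × Lᗮ) × E d) :
    rescaledPoints L r p ∈ crossingEvent L r ↔ (p.2.1, p.2.2.1.1, p.2.2.2) ∈ crossingSet L := by
  obtain ⟨⟨a, u⟩, x, ⟨y, w⟩, z⟩ := p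
  have hd : ∀ (b x : E d), dist b (b + r • x) ≤ r ↔ ‖x‖ ≤ 1 := by
    intro b x
    rw [dist_self_add_right, norm_smul, Real.norm_eq_abs, abs_of_pos hr]
    exact ⟨fun h => le_of_mul_le_mul_left (by linarith) hr, fun h => by nlinarith⟩
  simp only [rescaledPoints, crossingEvent, crossingSet, Set.mem_ofPred_eq, hd,
    mem_closedBall_zero_iff, orthogonalProjectionOnto_coe_add_coe]
  have h1 : ∀ (b : L) (u : Lᗮ) (x : E d),
      L.orthogonalProjectionOnto ((b : E d) + u + r • x) =
        b + r • L.orthogonalProjectionOnto x := by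
    intro b u x
    rw [map_add, orthogonalProjectionOnto_coe_add_coe, map_smul]
  rw [h1, h1, segment_inter_segment_nonempty_comp_homothety hr.ne']
  refine and_congr_right fun hx => ?_
  constructor
  · rintro ⟨hz, h⟩
    refine ⟨?_, hz, h⟩
    rw [segment_inter_segment_nonempty_iff] at h
    obtain ⟨s, hs, t, ht, h⟩ := h
    have hy : y = s • L.orthogonalProjectionOnto x - t • L.orthogonalProjectionOnto z := by
      rw [eq_sub_iff_add_eq]
      simpa using h.symm
    have hb : ∀ (s : ℝ) (x : E d), s ∈ Set.Icc (0 : ℝ) 1 → ‖x‖ ≤ 1 →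
        ‖s • L.orthogonalProjectionOnto x‖ ≤ 1 := by
      intro s x hs hx
      rw [norm_smul, Real.norm_eq_abs, abs_of_nonneg hs.1]
      have := (L.norm_orthogonalProjectionOnto_apply_le x).trans hx
      exact mul_le_one₀ hs.2 (norm_nonneg _) this
    rw [hy]
    calc _ ≤ _ := norm_sub_le _ _
      _ ≤ 1 + 1 := add_le_add (hb s x hs hx) (hb t z ht hz)
      _ = 2 := by norm_num
  · rintro ⟨-, hz, h⟩
    exact ⟨hz, h⟩

theorem eventually_mem_iff_of_notMem_frontier {X : Type*} [TopologicalSpace X] {U : Set X}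
    (hU : IsOpen U) {x : X} (hx : x ∉ frontier U) : ∀ᶠ y in 𝓝 x, (y ∈ U ↔ x ∈ U) := by
  by_cases h : x ∈ U
  · filter_upwards [hU.mem_nhds h] with y hy
    simp [h, hy]
  · have hc : x ∈ (closure U)ᶜ := fun hc => hx (by
      rw [frontier, hU.interior_eq]; exact ⟨hc, h⟩)
    filter_upwards [isClosed_closure.isOpen_compl.mem_nhds hc] with y hy
    simp only [h, iff_false]
    exact fun hyU => hy (subset_closure hyU)

theorem ae_notMem_frontier {d : ℕ} (L : Submodule ℝ (E d)) {U : Set (E d)}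
    (hU : volume (frontier U) = 0) :
    ∀ᵐ p : (L × Lᗮ) × E d × (L × Lᗮ) × E d,
      (p.1.1 : E d) + p.1.2 ∉ frontier U ∧ (p.1.1 : E d) + p.2.2.1.2 ∉ frontier U := by
  have h0 : ∀ᵐ q : L × Lᗮ, (q.1 : E d) + q.2 ∉ frontier U :=
    (measurePreserving_coe_add_coe L).quasiMeasurePreserving.ae (measure_eq_zero_iff_ae_notMem.1 hU)
  have h1 : Measure.QuasiMeasurePreserving
      (fun p : (L × Lᗮ) × E d × (L × Lᗮ) × E d => p.1) volume volume :=
    Measure.quasiMeasurePreserving_fst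
  have h2 : Measure.QuasiMeasurePreserving
      (Prod.map Prod.fst (fun q : E d × (L × Lᗮ) × E d => q.2.1.2) :
        (L × Lᗮ) × E d × (L × Lᗮ) × E d → L × Lᗮ) volume volume :=
    QuasiMeasurePreserving.prodMap Measure.quasiMeasurePreserving_fst
      (Measure.quasiMeasurePreserving_snd.comp (Measure.quasiMeasurePreserving_fst.comp
        Measure.quasiMeasurePreserving_snd))
  filter_upwards [h1.ae h0, h2.ae h0] with p hp1 hp2
  exact ⟨hp1, hp2⟩

/-! ### The limiting integral and dominated convergence. -/

/-- The limit of the rescaled integrand. -/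
def limitConfigurations {d : ℕ} (L : Submodule ℝ (E d)) (U : Set (E d)) :
    Set ((L × Lᗮ) × E d × (L × Lᗮ) × E d) :=
  {p | (p.2.1, p.2.2.1.1, p.2.2.2) ∈ crossingSet L ∧
    (p.1.1 : E d) + p.1.2 ∈ U ∧ (p.1.1 : E d) + p.2.2.1.2 ∈ U}

theorem measurableSet_limitConfigurations {d : ℕ} (L : Submodule ℝ (E d)) {U : Set (E d)}
    (hU : MeasurableSet U) : MeasurableSet (limitConfigurations L U) := by
  have h1 : Measurable fun p : (L × Lᗮ) × E d × (L × Lᗮ) × E d =>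
      (p.2.1, p.2.2.1.1, p.2.2.2) := by fun_prop
  have h2 : Measurable fun p : (L × Lᗮ) × E d × (L × Lᗮ) × E d =>
      (p.1.1 : E d) + p.1.2 := by fun_prop
  have h3 : Measurable fun p : (L × Lᗮ) × E d × (L × Lᗮ) × E d =>
      (p.1.1 : E d) + p.2.2.1.2 := by fun_prop
  exact (h1 (isClosed_crossingSet L).measurableSet).inter ((h2 hU).inter (h3 hU))

/-- For fixed `a` the indicator is a product of functions of `u`, of `w` and of `(x, y, z)`. The
first two integrate to the same section volume, whence the square. -/
theorem volume_limitConfigurations {d : ℕ} (L : Submodule ℝ (E d)) {U : Set (E d)}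
    (hU : MeasurableSet U) :
    volume (limitConfigurations L U) = volume (crossingSet L) *
      ∫⁻ a : L, volume {u : Lᗮ | (a : E d) + (u : E d) ∈ U} ^ 2 := by
  have hS : ∀ a : L, MeasurableSet {u : Lᗮ | (a : E d) + (u : E d) ∈ U} := fun a =>
    (by fun_prop : Measurable fun u : Lᗮ => (a : E d) + (u : E d)) hU
  have hK := (isClosed_crossingSet L).measurableSet
  have hG : Measurable ((limitConfigurations L U).indicator
        (1 : (L × Lᗮ) × E d × (L × Lᗮ) × E d → ENNReal)) :=
    measurable_one.indicator (measurableSet_limitConfigurations L hU)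
  rw [← lintegral_indicator_one (measurableSet_limitConfigurations L hU), lintegral_nested L hG,
    ← lintegral_const_mul _ ((measurable_sectionVolume L hU).pow_const 2)]
  refine lintegral_congr fun a => ?_
  set S := {u : Lᗮ | (a : E d) + (u : E d) ∈ U} with hSdef
  have hprod : ∀ (u : Lᗮ) (x : E d) (y : L) (w : Lᗮ) (z : E d),
      (limitConfigurations L U).indicator
        (1 : (L × Lᗮ) × E d × (L × Lᗮ) × E d → ENNReal) ((a, u), x, (y, w), z) =
        S.indicator 1 u * (S.indicator 1 w * (crossingSet L).indicator 1 (x, y, z)) := by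
    intro u x y w z
    classical
    simp only [Set.indicator_apply, limitConfigurations, Set.mem_ofPred_eq, hSdef, Pi.one_apply]
    split_ifs <;> simp_all
  have hKm : Measurable ((crossingSet L).indicator (1 : E d × L × E d → ENNReal)) :=
    measurable_one.indicator hK
  have hSm : Measurable (S.indicator (1 : Lᗮ → ENNReal)) := measurable_one.indicator (hS a)
  have hSi : ∫⁻ u, S.indicator (1 : Lᗮ → ENNReal) u = volume S := lintegral_indicator_one (hS a)
  have hne : ∀ u, S.indicator (1 : Lᗮ → ENNReal) u ≠ ⊤ := fun u => by
    classical
    simp only [Set.indicator_apply, Pi.one_apply]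
    split_ifs <;> simp
  have hxyz : ∫⁻ x, ∫⁻ y, ∫⁻ z, (crossingSet L).indicator (1 : E d × L × E d → ENNReal) (x, y, z) =
      volume (crossingSet L) := by
    rw [← lintegral_indicator_one hK, Measure.volume_eq_prod, lintegral_prod _ hKm.aemeasurable]
    refine lintegral_congr fun x => ?_
    rw [Measure.volume_eq_prod, lintegral_prod]
    exact (hKm.comp measurable_prodMk_left).aemeasurable
  have hyz : Measurable fun x => ∫⁻ y, ∫⁻ z,
      (crossingSet L).indicator (1 : E d × L × E d → ENNReal) (x, y, z) := by
    have : Measurable fun q : E d × L => ∫⁻ z,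
        (crossingSet L).indicator (1 : E d × L × E d → ENNReal) (q.1, q.2, z) :=
      Measurable.lintegral_prod_right' (f := fun q : (E d × L) × E d =>
        (crossingSet L).indicator (1 : E d × L × E d → ENNReal) (q.1.1, q.1.2, q.2))
        (hKm.comp (by fun_prop))
    exact this.lintegral_prod_right'
  have hy : ∀ x, Measurable fun y => ∫⁻ z,
      (crossingSet L).indicator (1 : E d × L × E d → ENNReal) (x, y, z) := fun x =>
    Measurable.lintegral_prod_right' (f := fun q : L × E d =>
      (crossingSet L).indicator (1 : E d × L × E d → ENNReal) (x, q)) (hKm.comp (by fun_prop))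
  simp only [hprod]
  calc _ = ∫⁻ u, S.indicator 1 u * (volume S * volume (crossingSet L)) := by
        refine lintegral_congr fun u => ?_
        simp only [lintegral_const_mul' _ _ (hne _), lintegral_mul_const _ hSm, hSi]
        rw [← hxyz]
        congr 1
        rw [← lintegral_const_mul _ hyz]
        refine lintegral_congr fun x => ?_
        rw [← lintegral_const_mul _ (hy x)]
    _ = _ := by
        rw [lintegral_mul_const _ hSm, hSi]
        ring

theorem tendsto_lintegral_rescaled {d : ℕ} (L : Submodule ℝ (E d)) {U : Set (E d)}
    (hU : IsOpen U) (hb : Bornology.IsBounded U) (hfr : volume (frontier U) = 0) :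
    Tendsto (fun r : ℝ => ∫⁻ p,
        (crossingEvent L r ∩ (U ×ˢ U) ×ˢ (U ×ˢ U)).indicator
          (1 : (E d × E d) × (E d × E d) → ENNReal)
          (rescaledPoints L r p)) (𝓝[>] 0) (𝓝 (volume (limitConfigurations L U))) := by
  obtain ⟨R, hR⟩ := hb.subset_closedBall 0
  rw [← lintegral_indicator_one (measurableSet_limitConfigurations L hU.measurableSet)]
  -- A box independent of `r` that contains every contributing configuration; its indicator
  -- dominates.
  let B : Set ((L × Lᗮ) × E d × (L × Lᗮ) × E d) :=
    (Metric.closedBall 0 R ×ˢ Metric.closedBall 0 R) ×ˢ Metric.closedBall 0 1 ×ˢ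
      (Metric.closedBall 0 2 ×ˢ Metric.closedBall 0 R) ×ˢ Metric.closedBall 0 1
  have hB : MeasurableSet B :=
    ((Metric.isClosed_closedBall.prod Metric.isClosed_closedBall).prod
      (Metric.isClosed_closedBall.prod ((Metric.isClosed_closedBall.prod
        Metric.isClosed_closedBall).prod Metric.isClosed_closedBall))).measurableSet
  have hBfin : volume B ≠ ⊤ := by
    simp only [B, Measure.volume_eq_prod, Measure.prod_prod]
    exact (ENNReal.mul_lt_top (ENNReal.mul_lt_top measure_closedBall_lt_top
      measure_closedBall_lt_top) (ENNReal.mul_lt_top measure_closedBall_lt_top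
        (ENNReal.mul_lt_top (ENNReal.mul_lt_top measure_closedBall_lt_top
          measure_closedBall_lt_top) measure_closedBall_lt_top))).ne
  refine tendsto_lintegral_filter_of_dominated_convergence (B.indicator 1) ?_ ?_ ?_ ?_
  · refine Eventually.of_forall fun r => ?_
    have : MeasurableSet (crossingEvent L r ∩ (U ×ˢ U) ×ˢ (U ×ˢ U)) :=
      (isClosed_crossingEvent L r).measurableSet.inter
        ((hU.prod hU).prod (hU.prod hU)).measurableSet
    exact (measurable_one.indicator this).comp (continuous_rescaledPoints L r).measurable
  · filter_upwards [self_mem_nhdsWithin] with r hr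
    refine ae_of_all _ fun p => ?_
    by_cases hp : rescaledPoints L r p ∈ crossingEvent L r ∩ (U ×ˢ U) ×ˢ (U ×ˢ U)
    · have hpB : p ∈ B := by
        obtain ⟨hc, ⟨h1, h2⟩, h3, h4⟩ := hp
        rw [rescaledPoints_mem_crossingEvent_iff L hr] at hc
        obtain ⟨hx, hy, hz, -⟩ := hc
        have h1' := hR h1
        have h3' := hR h3
        rw [mem_closedBall_zero_iff] at h1' h3'
        refine ⟨⟨?_, ?_⟩, hx, ⟨hy, ?_⟩, hz⟩
        · exact mem_closedBall_zero_iff.2 ((norm_fst_le L _ _).trans h1')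
        · exact mem_closedBall_zero_iff.2 ((norm_snd_le L _ _).trans h1')
        · exact mem_closedBall_zero_iff.2 ((norm_snd_le L _ _).trans h3')
      simp [Set.indicator_of_mem hp, Set.indicator_of_mem hpB]
    · simp [Set.indicator_of_notMem hp]
  · rw [lintegral_indicator_one hB]
    exact hBfin
  -- As `r → 0` the four points tend to `a + u` (twice) and `a + w` (twice). When neither limit is
  -- on the frontier, membership in `U` is eventually constant, and so is the integrand.
  · filter_upwards [ae_notMem_frontier L hfr] with p hp
    refine Tendsto.congr' ?_ tendsto_const_nhds
    have hlim : ∀ {g : ℝ → E d}, Continuous g → g 0 ∉ frontier U →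
        ∀ᶠ r in 𝓝[>] (0 : ℝ), (g r ∈ U ↔ g 0 ∈ U) := fun hg h0 =>
      (hg.tendsto 0).eventually (eventually_mem_iff_of_notMem_frontier hU h0)
        |>.filter_mono nhdsWithin_le_nhds
    obtain ⟨⟨a, u⟩, x, ⟨y, w⟩, z⟩ := p
    obtain ⟨hp1, hp2⟩ := hp
    have e1 := hlim (g := fun r => (a : E d) + u + r • x) (by fun_prop) (by simpa using hp1)
    have e2 := hlim (g := fun r => ((a + r • y : L) : E d) + w) (by fun_prop) (by simpa using hp2)
    have e3 := hlim (g := fun r => ((a + r • y : L) : E d) + w + r • z) (by fun_prop)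
      (by simpa using hp2)
    filter_upwards [self_mem_nhdsWithin, e1, e2, e3] with r hr h1 h2 h3
    have hiff : ((a, u), x, (y, w), z) ∈ limitConfigurations L U ↔
        rescaledPoints L r ((a, u), x, (y, w), z) ∈
          crossingEvent L r ∩ (U ×ˢ U) ×ˢ (U ×ˢ U) := by
      rw [Set.mem_inter_iff, rescaledPoints_mem_crossingEvent_iff L hr]
      simp only [zero_smul, add_zero] at h1 h2 h3
      simp only [limitConfigurations, rescaledPoints, Set.mem_prod, Set.mem_ofPred_eq, h1, h2, h3]
      tauto
    classical
    simp only [Set.indicator_apply, hiff, Pi.one_apply]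

theorem tendsto_measure_crossingEvent {d : ℕ} (L : Submodule ℝ (E d))
    (hL : Module.finrank ℝ L = 2) {U : Set (E d)} (hU : IsOpen U)
    (hb : Bornology.IsBounded U) (hfr : volume (frontier U) = 0) :
    Tendsto (fun r : ℝ => (((volume.restrict U).prod (volume.restrict U)).prod
        ((volume.restrict U).prod (volume.restrict U))) (crossingEvent L r) /
          ENNReal.ofReal (r ^ (2 * d + 2))) (𝓝[>] 0)
      (𝓝 (volume (crossingSet L) *
        ∫⁻ a : L, volume {u : Lᗮ | (a : E d) + (u : E d) ∈ U} ^ 2)) := by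
  rw [← volume_limitConfigurations L hU.measurableSet]
  refine (tendsto_lintegral_rescaled L hU hb hfr).congr' ?_
  filter_upwards [self_mem_nhdsWithin] with r hr
  have hr : 0 < r := hr
  have hmeas : MeasurableSet (crossingEvent L r ∩ (U ×ˢ U) ×ˢ (U ×ˢ U)) :=
    (isClosed_crossingEvent L r).measurableSet.inter
      ((hU.prod hU).prod (hU.prod hU)).measurableSet
  have hpos : ENNReal.ofReal (r ^ (2 * d + 2)) ≠ 0 := by
    rw [Ne, ENNReal.ofReal_eq_zero, not_le]
    positivity
  rw [Measure.prod_restrict, Measure.prod_restrict,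
    Measure.restrict_apply (isClosed_crossingEvent L r).measurableSet,
    ← Measure.volume_eq_prod, ← Measure.volume_eq_prod, ← lintegral_indicator_one hmeas,
    lintegral_eq_mul_lintegral_rescaledPoints L hL hr (measurable_one.indicator hmeas),
    mul_comm, ENNReal.mul_div_cancel_right hpos ENNReal.ofReal_ne_top]

/-! ### Crossings among independent points -/

/-- Integrating out one coordinate that is constrained to a set of measure at most `g`. -/
theorem lintegral_mul_indicator_le {ι α : Type*} [Fintype ι] [DecidableEq ι] [MeasurableSpace α]
    (μ : Measure α) [IsProbabilityMeasure μ] {H : (ι → α) → ENNReal} (hH : Measurable H) (b : ι)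
    (hHb : ∀ x y, H (Function.update x b y) = H x) {R : Set (ι → α)} (hR : MeasurableSet R)
    {g : ENNReal} (hg : ∀ x, μ {y | Function.update x b y ∈ R} ≤ g) :
    ∫⁻ x, H x * R.indicator 1 x ∂Measure.pi (fun _ => μ) ≤
      g * ∫⁻ x, H x ∂Measure.pi (fun _ => μ) := by
  have hR1 : Measurable (R.indicator (1 : (ι → α) → ENNReal)) := measurable_one.indicator hR
  rw [← lintegral_const_mul _ hH]
  refine lintegral_le_of_lmarginal_le {b} (hH.mul hR1) (hH.const_mul g) ?_
  intro x
  rw [lmarginal_singleton, lmarginal_singleton]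
  simp only [hHb, lintegral_const, measure_univ, mul_one]
  have hm : Measurable fun y => R.indicator (1 : (ι → α) → ENNReal) (Function.update x b y) :=
    hR1.comp (measurable_update x)
  rw [lintegral_const_mul _ hm, mul_comm]
  gcongr
  refine le_trans (le_of_eq ?_) (hg x)
  exact lintegral_indicator_one (measurable_update x hR)

/-! ### Geometric constraints of a crossing, and overlapping quadruples. -/

/-- The other endpoint of the edge that contains the `l`-th of the four points. -/
def partner : Fin 4 → Fin 4 := ![1, 0, 3, 2]

/-- The constraints that a crossing imposes on the points with index in `B`. -/
def nearEvent {d : ℕ} (L : Submodule ℝ (E d)) (r : ℝ) (B : Finset (Fin 4)) : Set (Fin 4 → E d) :=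
  {v | ∀ l ∈ B, ∀ m ∈ B,
    dist (L.orthogonalProjectionOnto (v l)) (L.orthogonalProjectionOnto (v m)) ≤ 2 * r ∧
      (m = partner l → dist (v l) (v m) ≤ r)}

theorem isClosed_nearEvent {d : ℕ} (L : Submodule ℝ (E d)) (r : ℝ) (B : Finset (Fin 4)) :
    IsClosed (nearEvent L r B) := by
  simp only [nearEvent, Set.ofPred_forall, Set.ofPred_and]
  refine isClosed_biInter fun l _ => isClosed_biInter fun m _ => IsClosed.inter ?_ ?_
  · exact isClosed_le (by fun_prop) continuous_const
  · exact isClosed_iInter fun _ => isClosed_le (by fun_prop) continuous_const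

/-- The four-point configurations with a crossing. -/
def crossingTuples {d : ℕ} (L : Submodule ℝ (E d)) (r : ℝ) : Set (Fin 4 → E d) :=
  {v | ((v 0, v 1), (v 2, v 3)) ∈ crossingEvent L r}

theorem measurableSet_crossingTuples {d : ℕ} (L : Submodule ℝ (E d)) (r : ℝ) :
    MeasurableSet (crossingTuples L r) :=
  ((isClosed_crossingEvent L r).preimage (f := fun v : Fin 4 → E d => ((v 0, v 1), (v 2, v 3)))
    (by fun_prop)).measurableSet

theorem dist_projection_le {d : ℕ} (L : Submodule ℝ (E d)) {r : ℝ} {a b : E d}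
    (hab : dist a b ≤ r) {x : L}
    (hx : x ∈ segment ℝ (L.orthogonalProjectionOnto a) (L.orthogonalProjectionOnto b)) :
    dist (L.orthogonalProjectionOnto a) x ≤ r ∧ dist (L.orthogonalProjectionOnto b) x ≤ r := by
  have h : dist (L.orthogonalProjectionOnto a) (L.orthogonalProjectionOnto b) ≤ r := by
    rw [dist_eq_norm, ← map_sub]
    exact (L.norm_orthogonalProjectionOnto_apply_le _).trans (by rwa [← dist_eq_norm])
  have h2 := dist_add_dist_of_mem_segment hx
  have h3 := dist_nonneg (x := L.orthogonalProjectionOnto a) (y := x)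
  have h4 := dist_nonneg (x := x) (y := L.orthogonalProjectionOnto b)
  rw [dist_comm (L.orthogonalProjectionOnto b) x]
  constructor <;> linarith

theorem crossingTuples_subset_nearEvent {d : ℕ} (L : Submodule ℝ (E d)) (r : ℝ) :
    crossingTuples L r ⊆ nearEvent L r Finset.univ := by
  rintro v ⟨h01, h23, x, hx1, hx2⟩
  have hx : ∀ l : Fin 4, dist (L.orthogonalProjectionOnto (v l)) x ≤ r := by
    obtain ⟨h0, h1⟩ := dist_projection_le L h01 hx1
    obtain ⟨h2, h3⟩ := dist_projection_le L h23 hx2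
    intro l
    fin_cases l <;> assumption
  refine fun l _ m _ => ⟨?_, ?_⟩
  · have := dist_triangle_right (L.orthogonalProjectionOnto (v l))
      (L.orthogonalProjectionOnto (v m)) x
    linarith [hx l, hx m]
  · rintro rfl
    fin_cases l
    · exact h01
    · exact (dist_comm _ _).trans_le h01
    · exact h23
    · exact (dist_comm _ _).trans_le h23

/-- Neither `H` nor the constraints on `B` involve the coordinate `j l`, so it can be integrated out
first, at a cost of at most `g`. -/
theorem lintegral_nearEvent_insert_le {d : ℕ} (L : Submodule ℝ (E d)) (r : ℝ)
    (μ : Measure (E d)) [IsProbabilityMeasure μ] {ι : Type*} [Fintype ι] [DecidableEq ι]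
    {H : (ι → E d) → ENNReal} (hH : Measurable H)
    {j : Fin 4 → ι} (hj : Function.Injective j) {B : Finset (Fin 4)} {l : Fin 4} (hl : l ∉ B)
    (hHl : ∀ x y, H (Function.update x (j l) y) = H x) {g : ENNReal}
    (hg : ∀ v : Fin 4 → E d, μ {y | Function.update v l y ∈ nearEvent L r (insert l B)} ≤ g) :
    ∫⁻ x, H x * (nearEvent L r (insert l B)).indicator 1 (x ∘ j) ∂Measure.pi (fun _ => μ) ≤
      g * ∫⁻ x, H x * (nearEvent L r B).indicator 1 (x ∘ j) ∂Measure.pi (fun _ => μ) := by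
  have hjm : Measurable fun x : ι → E d => x ∘ j := by
    refine measurable_pi_lambda _ fun k => ?_
    exact measurable_pi_apply _
  have hupd : ∀ (x : ι → E d) y, Function.update x (j l) y ∘ j = Function.update (x ∘ j) l y :=
    fun x y => Function.update_comp_eq_of_injective x hj l y
  have hsub : nearEvent L r (insert l B) ⊆ nearEvent L r B := fun v hv a ha b hb =>
    hv a (Finset.mem_insert_of_mem ha) b (Finset.mem_insert_of_mem hb)
  have hind : ∀ x : ι → E d, H x * (nearEvent L r (insert l B)).indicator 1 (x ∘ j) =
      (H x * (nearEvent L r B).indicator 1 (x ∘ j)) *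
        ((fun x : ι → E d => x ∘ j) ⁻¹' nearEvent L r (insert l B)).indicator 1 x := by
    intro x
    by_cases hx : x ∘ j ∈ nearEvent L r (insert l B)
    · have hx' : x ∈ (fun x : ι → E d => x ∘ j) ⁻¹' nearEvent L r (insert l B) := hx
      rw [Set.indicator_of_mem hx, Set.indicator_of_mem (hsub hx), Set.indicator_of_mem hx']
      simp
    · have hx' : x ∉ (fun x : ι → E d => x ∘ j) ⁻¹' nearEvent L r (insert l B) := hx
      rw [Set.indicator_of_notMem hx, Set.indicator_of_notMem hx']
      simp
  simp only [hind]
  refine lintegral_mul_indicator_le μ (hH.mul ((measurable_one.indicator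
    (isClosed_nearEvent L r B).measurableSet).comp hjm)) (j l) ?_
    (hjm (isClosed_nearEvent L r _).measurableSet) ?_
  · intro x y
    change H _ * (nearEvent L r B).indicator 1 (Function.update x (j l) y ∘ j) =
      H x * (nearEvent L r B).indicator 1 (x ∘ j)
    rw [hHl, hupd]
    congr 1
    have : Function.update (x ∘ j) l y ∈ nearEvent L r B ↔ x ∘ j ∈ nearEvent L r B := by
      refine forall₂_congr fun a ha => forall₂_congr fun b hb => ?_
      have ha' : a ≠ l := fun h => hl (h ▸ ha)
      have hb' : b ≠ l := fun h => hl (h ▸ hb)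
      rw [Function.update_of_ne ha', Function.update_of_ne hb']
    classical
    simp only [Set.indicator_apply, this, Pi.one_apply]
  · intro x
    refine le_trans (le_of_eq ?_) (hg (x ∘ j))
    simp only [Set.mem_preimage, hupd]

theorem measure_update_nearEvent_le {d : ℕ} {L : Submodule ℝ (E d)} {r : ℝ} {μ : Measure (E d)}
    {c₂ : ENNReal} (h₂ : ∀ a : L, μ {y | dist (L.orthogonalProjectionOnto y) a ≤ 2 * r} ≤ c₂)
    {B : Finset (Fin 4)} {l : Fin 4} (hl : l ∉ B)
    (hB : B.Nonempty) (v : Fin 4 → E d) :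
    μ {y | Function.update v l y ∈ nearEvent L r (insert l B)} ≤ c₂ := by
  obtain ⟨m, hm⟩ := hB
  have hml : m ≠ l := fun h => hl (h ▸ hm)
  refine (measure_mono fun y hy => ?_).trans (h₂ (L.orthogonalProjectionOnto (v m)))
  have := (hy l (Finset.mem_insert_self _ _) m (Finset.mem_insert_of_mem hm)).1
  rwa [Function.update_self, Function.update_of_ne hml] at this

theorem measure_update_nearEvent_le_of_partner_mem {d : ℕ} {L : Submodule ℝ (E d)} {r : ℝ}
    {μ : Measure (E d)} {cd : ENNReal} (hd : ∀ a : E d, μ {y | dist y a ≤ r} ≤ cd)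
    {B : Finset (Fin 4)} {l : Fin 4} (hl : l ∉ B)
    (hB : partner l ∈ B) (v : Fin 4 → E d) :
    μ {y | Function.update v l y ∈ nearEvent L r (insert l B)} ≤ cd := by
  have hml : partner l ≠ l := fun h => hl (h ▸ hB)
  refine (measure_mono fun y hy => ?_).trans (hd (v (partner l)))
  have := (hy l (Finset.mem_insert_self _ _) _ (Finset.mem_insert_of_mem hB)).2 rfl
  rwa [Function.update_self, Function.update_of_ne hml] at this

/-- Bound for the probability of a crossing, given `k` of its four points. -/
def overlapBound {R : Type*} [CommSemiring R] (c₂ cd : R) : ℕ → R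
  -- Quadruples without a common index are uncorrelated, so this value serves as a covariance bound.
  | 0 => 0
  | 1 => cd * (c₂ * cd)
  | 2 => cd * c₂
  | 3 => cd
  | _ => 1

theorem exists_partner_mem_of_card_three {B : Finset (Fin 4)} (hB : B.card = 3) :
    ∃ l, l ∉ B ∧ partner l ∈ B ∧ insert l B = Finset.univ := by
  revert B
  decide

theorem exists_notMem_of_card_two {B : Finset (Fin 4)} (hB : B.card = 2) :
    ∃ l, l ∉ B ∧ (insert l B).card = 3 := by
  revert B
  decide

theorem exists_partner_mem_of_card_one {B : Finset (Fin 4)} (hB : B.card = 1) :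
    ∃ l, l ∉ B ∧ partner l ∈ B ∧ (insert l B).card = 2 := by
  revert B
  decide

/-- Points are added to `B` in a favourable order. A single point first receives its partner (`cd`);
from two points any third is added (`c₂`); the fourth always has its partner present (`cd`). Two
points on different edges would allow `cd * cd`, but the weaker `cd * c₂` suffices. -/
theorem lintegral_nearEvent_univ_le {d : ℕ} {L : Submodule ℝ (E d)} {r : ℝ} {μ : Measure (E d)}
    [IsProbabilityMeasure μ] {c₂ cd : ENNReal}
    (h₂ : ∀ a : L, μ {y | dist (L.orthogonalProjectionOnto y) a ≤ 2 * r} ≤ c₂)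
    (hd : ∀ a : E d, μ {y | dist y a ≤ r} ≤ cd) {ι : Type*} [Fintype ι] [DecidableEq ι]
    {H : (ι → E d) → ENNReal} (hH : Measurable H) {j : Fin 4 → ι} (hj : Function.Injective j)
    {B : Finset (Fin 4)} (hB : B.Nonempty)
    (hHl : ∀ l ∉ B, ∀ x y, H (Function.update x (j l) y) = H x) :
    ∫⁻ x, H x * (nearEvent L r Finset.univ).indicator 1 (x ∘ j) ∂Measure.pi (fun _ => μ) ≤
      overlapBound c₂ cd B.card *
        ∫⁻ x, H x * (nearEvent L r B).indicator 1 (x ∘ j) ∂Measure.pi (fun _ => μ) := by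
  have three : ∀ B : Finset (Fin 4), (∀ l ∉ B, ∀ x y, H (Function.update x (j l) y) = H x) →
      B.card = 3 →
      ∫⁻ x, H x * (nearEvent L r Finset.univ).indicator 1 (x ∘ j) ∂Measure.pi (fun _ => μ) ≤
      cd * ∫⁻ x, H x * (nearEvent L r B).indicator 1 (x ∘ j) ∂Measure.pi (fun _ => μ) := by
    intro B hHl hB
    obtain ⟨l, hl, hp, hu⟩ := exists_partner_mem_of_card_three hB
    rw [← hu]
    exact lintegral_nearEvent_insert_le L r μ hH hj hl (hHl l hl)
      (measure_update_nearEvent_le_of_partner_mem hd hl hp)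
  have two : ∀ B : Finset (Fin 4), (∀ l ∉ B, ∀ x y, H (Function.update x (j l) y) = H x) →
      B.card = 2 →
      ∫⁻ x, H x * (nearEvent L r Finset.univ).indicator 1 (x ∘ j) ∂Measure.pi (fun _ => μ) ≤
      cd * c₂ * ∫⁻ x, H x * (nearEvent L r B).indicator 1 (x ∘ j) ∂Measure.pi (fun _ => μ) := by
    intro B hHl hB
    obtain ⟨l, hl, hc⟩ := exists_notMem_of_card_two hB
    refine (three (insert l B) (fun m hm => hHl m fun h => hm (Finset.mem_insert_of_mem h))
      hc).trans ?_
    rw [mul_assoc]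
    gcongr
    exact lintegral_nearEvent_insert_le L r μ hH hj hl (hHl l hl)
      (measure_update_nearEvent_le h₂ hl (Finset.card_pos.1 (by omega)))
  obtain h | h | h | h : B.card = 1 ∨ B.card = 2 ∨ B.card = 3 ∨ B.card = 4 := by
    have h1 := Finset.card_pos.2 hB
    have h2 := Finset.card_le_univ B
    rw [Fintype.card_fin] at h2
    omega
  · rw [h]
    obtain ⟨l, hl, hp, hc⟩ := exists_partner_mem_of_card_one h
    refine (two (insert l B) (fun m hm => hHl m fun h => hm (Finset.mem_insert_of_mem h))
      hc).trans ?_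
    rw [show overlapBound c₂ cd 1 = (cd * c₂) * cd by simp only [overlapBound]; ring,
      mul_assoc _ cd]
    gcongr
    exact lintegral_nearEvent_insert_le L r μ hH hj hl (hHl l hl)
      (measure_update_nearEvent_le_of_partner_mem hd hl hp)
  · rw [h]
    exact two B hHl h
  · rw [h]
    exact three B hHl h
  · rw [h, (Finset.card_eq_iff_eq_univ B).1 (by simpa using h)]
    simp [overlapBound]

/-- The indices of `j` that are shared with `i`. -/
def sharedIndices {ι : Type*} [DecidableEq ι] (i j : Fin 4 → ι) : Finset (Fin 4) :=
  Finset.univ.filter fun l => j l ∈ Finset.univ.image i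

theorem measurableSet_preimage_crossingTuples {d : ℕ} (L : Submodule ℝ (E d)) (r : ℝ)
    {ι : Type*} (i : Fin 4 → ι) :
    MeasurableSet {x : ι → E d | x ∘ i ∈ crossingTuples L r} := by
  have : Measurable fun x : ι → E d => x ∘ i :=
    measurable_pi_lambda _ fun k => measurable_pi_apply _
  exact this (measurableSet_crossingTuples L r)

/-- The crossing at `i` plays the role of `H`: it does not depend on the points of `j` that are not
shared with `i`. -/
theorem measure_inter_crossingTuples_le {d : ℕ} {L : Submodule ℝ (E d)} {r : ℝ} {μ : Measure (E d)}
    [IsProbabilityMeasure μ] {c₂ cd : ENNReal}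
    (h₂ : ∀ a : L, μ {y | dist (L.orthogonalProjectionOnto y) a ≤ 2 * r} ≤ c₂)
    (hd : ∀ a : E d, μ {y | dist y a ≤ r} ≤ cd) {ι : Type*} [Fintype ι] [DecidableEq ι]
    {i j : Fin 4 → ι} (hj : Function.Injective j) (hij : (sharedIndices i j).Nonempty) :
    Measure.pi (fun _ : ι => μ) ({x | x ∘ i ∈ crossingTuples L r} ∩
        {x | x ∘ j ∈ crossingTuples L r}) ≤
      overlapBound c₂ cd (sharedIndices i j).card *
        Measure.pi (fun _ : ι => μ) {x | x ∘ i ∈ crossingTuples L r} := by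
  set F : Set (ι → E d) := {x | x ∘ i ∈ crossingTuples L r} with hF
  have hFm : MeasurableSet F := measurableSet_preimage_crossingTuples L r i
  have hFj : MeasurableSet {x : ι → E d | x ∘ j ∈ crossingTuples L r} :=
    measurableSet_preimage_crossingTuples L r j
  have hH : Measurable (F.indicator (1 : (ι → E d) → ENNReal)) := measurable_one.indicator hFm
  rw [← lintegral_indicator_one (hFm.inter hFj), ← lintegral_indicator_one hFm]
  calc ∫⁻ x, (F ∩ {x | x ∘ j ∈ crossingTuples L r}).indicator 1 x ∂Measure.pi (fun _ => μ)
      ≤ ∫⁻ x, F.indicator 1 x * (nearEvent L r Finset.univ).indicator 1 (x ∘ j)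
          ∂Measure.pi (fun _ => μ) := by
        refine lintegral_mono fun x => ?_
        refine Set.indicator_apply_le' (fun hx => ?_) fun _ => zero_le
        rw [Set.indicator_of_mem hx.1,
          Set.indicator_of_mem (crossingTuples_subset_nearEvent L r hx.2)]
        simp
    _ ≤ overlapBound c₂ cd (sharedIndices i j).card *
        ∫⁻ x, F.indicator 1 x * (nearEvent L r (sharedIndices i j)).indicator 1 (x ∘ j)
          ∂Measure.pi (fun _ => μ) := by
        refine lintegral_nearEvent_univ_le h₂ hd hH hj hij fun l hl x y => ?_
        have hne : ∀ k, i k ≠ j l := by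
          intro k hk
          refine hl ?_
          simp only [sharedIndices, Finset.mem_filter, Finset.mem_univ, Finset.mem_image, true_and]
          exact ⟨k, hk⟩
        have hc : Function.update x (j l) y ∘ i = x ∘ i := by
          ext1 k
          simp [Function.update_of_ne (hne k)]
        classical
        simp only [Set.indicator_apply, hF, Set.mem_ofPred_eq, hc, Pi.one_apply]
    _ ≤ _ := by
        gcongr with x
        refine mul_le_of_le_one_right' ?_
        exact Set.indicator_apply_le' (fun _ => le_rfl) fun _ => zero_le

/-! ### Mean and variance of the number of crossings among `n` independent points. -/

/-- The injective quadruples of indices below `n`. -/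
def injectiveTuples (n : ℕ) : Finset (Fin 4 → Fin n) :=
  Finset.univ.filter Function.Injective

theorem card_injectiveTuples (n : ℕ) : (injectiveTuples n).card = n.descFactorial 4 := by
  have h : Fintype.card {f : Fin 4 → Fin n // Function.Injective f} = (injectiveTuples n).card :=
    Fintype.card_subtype _
  rw [← h, Fintype.card_congr (Equiv.subtypeInjectiveEquivEmbedding (Fin 4) (Fin n)),
    Fintype.card_embedding_eq]
  simp

theorem card_injectiveTuples_le (n : ℕ) : (injectiveTuples n).card ≤ n ^ 4 := by
  refine (Finset.card_filter_le _ _).trans ?_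
  simp

/-- The indicator of a crossing among the points with indices `i`. -/
def crossingIndicator {d : ℕ} (L : Submodule ℝ (E d)) (r : ℝ) {ι : Type*} (i : Fin 4 → ι) :
    (ι → E d) → ℝ :=
  Set.indicator {x | x ∘ i ∈ crossingTuples L r} 1

/-- The number of ordered quadruples of indices that give a crossing. -/
def crossingCount {d : ℕ} (L : Submodule ℝ (E d)) (r : ℝ) (n : ℕ) (x : Fin n → E d) : ℝ :=
  ∑ i ∈ injectiveTuples n, crossingIndicator L r i x

/-- The probability that four independent points give a crossing. -/
def crossingProbability {d : ℕ} (L : Submodule ℝ (E d)) (r : ℝ) (μ : Measure (E d)) : ℝ :=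
  ((μ.prod μ).prod (μ.prod μ)).real (crossingEvent L r)

theorem measurable_crossingIndicator {d : ℕ} (L : Submodule ℝ (E d)) (r : ℝ) {ι : Type*}
    (i : Fin 4 → ι) : Measurable (crossingIndicator L r i) :=
  measurable_one.indicator (measurableSet_preimage_crossingTuples L r i)

theorem measurable_crossingCount {d : ℕ} (L : Submodule ℝ (E d)) (r : ℝ) (n : ℕ) :
    Measurable (crossingCount L r n) :=
  Finset.measurable_fun_sum _ fun i _ => measurable_crossingIndicator L r i

theorem crossingIndicator_nonneg {d : ℕ} (L : Submodule ℝ (E d)) (r : ℝ) {ι : Type*}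
    (i : Fin 4 → ι) (x : ι → E d) : 0 ≤ crossingIndicator L r i x :=
  Set.indicator_nonneg (fun _ _ => zero_le_one) x

theorem memLp_crossingIndicator {d : ℕ} (L : Submodule ℝ (E d)) (r : ℝ) {ι : Type*}
    (i : Fin 4 → ι) (P : Measure (ι → E d)) [IsFiniteMeasure P] :
    MemLp (crossingIndicator L r i) 2 P := by
  refine MemLp.of_bound (measurable_crossingIndicator L r i).aestronglyMeasurable 1
    (ae_of_all _ fun x => ?_)
  rw [Real.norm_eq_abs, abs_of_nonneg (crossingIndicator_nonneg L r i x)]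
  exact Set.indicator_apply_le' (fun _ => le_rfl) fun _ => zero_le_one

theorem memLp_crossingCount {d : ℕ} (L : Submodule ℝ (E d)) (r : ℝ) (n : ℕ)
    (P : Measure (Fin n → E d)) [IsFiniteMeasure P] : MemLp (crossingCount L r n) 2 P :=
  memLp_finsetSum _ fun i _ => memLp_crossingIndicator L r i P

theorem iIndepFun_eval {α ι : Type*} [Fintype ι] [MeasurableSpace α] (μ : Measure α)
    [IsProbabilityMeasure μ] :
    iIndepFun (fun (k : ι) (x : ι → α) => x k) (Measure.pi fun _ => μ) :=
  iIndepFun_pi (X := fun _ x => x) fun _ => aemeasurable_id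

theorem measure_crossingTuples {d : ℕ} (L : Submodule ℝ (E d)) (r : ℝ) (μ : Measure (E d))
    [IsProbabilityMeasure μ] {ι : Type*} [Fintype ι] {i : Fin 4 → ι} (hi : Function.Injective i) :
    Measure.pi (fun _ : ι => μ) {x | x ∘ i ∈ crossingTuples L r} =
      ((μ.prod μ).prod (μ.prod μ)) (crossingEvent L r) := by
  have hm : ∀ k : ι, Measurable fun x : ι → E d => x k := fun k => measurable_pi_apply k
  have hmap : ∀ k : ι, Measure.map (fun x : ι → E d => x k) (Measure.pi fun _ => μ) = μ :=
    fun k => (measurePreserving_eval (fun _ : ι => μ) k).map_eq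
  have hpair : ∀ k l : ι, k ≠ l →
      Measure.map (fun x : ι → E d => (x k, x l)) (Measure.pi fun _ => μ) = μ.prod μ := by
    intro k l hkl
    rw [(indepFun_iff_map_prod_eq_prod_map_map (hm k).aemeasurable (hm l).aemeasurable).1
      ((iIndepFun_eval μ).indepFun hkl), hmap, hmap]
  have hquad : Measure.map (fun x : ι → E d => ((x (i 0), x (i 1)), (x (i 2), x (i 3))))
      (Measure.pi fun _ => μ) = (μ.prod μ).prod (μ.prod μ) := by
    rw [(indepFun_iff_map_prod_eq_prod_map_map
      ((hm (i 0)).prodMk (hm (i 1))).aemeasurable ((hm (i 2)).prodMk (hm (i 3))).aemeasurable).1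
      ((iIndepFun_eval μ).indepFun_prodMk_prodMk hm _ _ _ _ (hi.ne (by decide))
        (hi.ne (by decide)) (hi.ne (by decide)) (hi.ne (by decide))),
      hpair _ _ (hi.ne (by decide)), hpair _ _ (hi.ne (by decide))]
  rw [← hquad, Measure.map_apply (by fun_prop) (isClosed_crossingEvent L r).measurableSet]
  rfl

theorem integral_crossingIndicator {d : ℕ} (L : Submodule ℝ (E d)) (r : ℝ) (μ : Measure (E d))
    [IsProbabilityMeasure μ] {ι : Type*} [Fintype ι] {i : Fin 4 → ι} (hi : Function.Injective i) :
    ∫ x, crossingIndicator L r i x ∂Measure.pi (fun _ => μ) = crossingProbability L r μ := by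
  unfold crossingIndicator crossingProbability
  rw [integral_indicator_one (measurableSet_preimage_crossingTuples L r i), Measure.real,
    measure_crossingTuples L r μ hi]
  rfl

theorem integral_crossingCount {d : ℕ} (L : Submodule ℝ (E d)) (r : ℝ) (μ : Measure (E d))
    [IsProbabilityMeasure μ] (n : ℕ) :
    ∫ x, crossingCount L r n x ∂Measure.pi (fun _ => μ) =
      n.descFactorial 4 * crossingProbability L r μ := by
  unfold crossingCount
  rw [integral_finsetSum _ fun i _ =>
    (memLp_crossingIndicator L r i (Measure.pi fun _ => μ)).integrable one_le_two,
    Finset.sum_congr (s₁ := injectiveTuples n) rfl fun i hi =>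
      integral_crossingIndicator L r μ (Finset.mem_filter.1 hi).2, Finset.sum_const, card_injectiveTuples, nsmul_eq_mul]

theorem covariance_crossingIndicator_of_disjoint {d : ℕ} (L : Submodule ℝ (E d)) (r : ℝ)
    (μ : Measure (E d)) [IsProbabilityMeasure μ] {ι : Type*} [Fintype ι] [DecidableEq ι]
    {i j : Fin 4 → ι} (hij : ¬(sharedIndices i j).Nonempty) :
    cov[crossingIndicator L r i, crossingIndicator L r j; Measure.pi fun _ => μ] = 0 := by
  have hdisj : Disjoint (Finset.univ.image i) (Finset.univ.image j) := by
    rw [Finset.disjoint_left]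
    intro k hk hkj
    obtain ⟨l, -, rfl⟩ := Finset.mem_image.1 hkj
    exact hij ⟨l, Finset.mem_filter.2 ⟨Finset.mem_univ _, hk⟩⟩
  have hind := (iIndepFun_eval (ι := ι) μ).indepFun_finset _ _ hdisj
    fun k => measurable_pi_apply k
  have hφ : ∀ k : Fin 4 → ι, ∃ φ : (↥(Finset.univ.image k) → E d) → ℝ, Measurable φ ∧
      crossingIndicator L r k = φ ∘ fun x l => x l := by
    intro k
    let k' : Fin 4 → ↥(Finset.univ.image k) :=
      fun l => ⟨k l, Finset.mem_image_of_mem _ (Finset.mem_univ _)⟩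
    exact ⟨crossingIndicator L r k', measurable_crossingIndicator L r k', rfl⟩
  obtain ⟨φ, hφm, hφ'⟩ := hφ i
  obtain ⟨ψ, hψm, hψ'⟩ := hφ j
  refine IndepFun.covariance_eq_zero ?_ (memLp_crossingIndicator L r i _)
    (memLp_crossingIndicator L r j _)
  rw [hφ', hψ']
  exact hind.comp hφm hψm

theorem ofReal_overlapBound {c₂ cd : ℝ} (h₂ : 0 ≤ c₂) (hd : 0 ≤ cd) (k : ℕ) :
    overlapBound (ENNReal.ofReal c₂) (ENNReal.ofReal cd) k =
      ENNReal.ofReal (overlapBound c₂ cd k) := by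
  match k with
  | 0 => simp [overlapBound]
  | 1 => simp [overlapBound, ENNReal.ofReal_mul, h₂, hd]
  | 2 => simp [overlapBound, ENNReal.ofReal_mul, hd]
  | 3 => simp [overlapBound]
  | _ + 4 => simp [overlapBound]

theorem overlapBound_nonneg {c₂ cd : ℝ} (h₂ : 0 ≤ c₂) (hd : 0 ≤ cd) (k : ℕ) :
    0 ≤ overlapBound c₂ cd k := by
  match k with
  | 0 => simp [overlapBound]
  | 1 => simp only [overlapBound]; positivity
  | 2 => simp only [overlapBound]; positivity
  | 3 => simpa only [overlapBound]
  | _ + 4 => simp [overlapBound]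

theorem covariance_crossingIndicator_le {d : ℕ} {L : Submodule ℝ (E d)} {r : ℝ} {μ : Measure (E d)}
    [IsProbabilityMeasure μ] {c₂ cd : ℝ} (hc₂ : 0 ≤ c₂) (hcd : 0 ≤ cd)
    (h₂ : ∀ a : L,
      μ {y | dist (L.orthogonalProjectionOnto y) a ≤ 2 * r} ≤ ENNReal.ofReal c₂)
    (hd : ∀ a : E d, μ {y | dist y a ≤ r} ≤ ENNReal.ofReal cd) {ι : Type*} [Fintype ι]
    [DecidableEq ι] {i j : Fin 4 → ι} (hi : Function.Injective i) (hj : Function.Injective j) :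
    cov[crossingIndicator L r i, crossingIndicator L r j; Measure.pi fun _ => μ] ≤
      overlapBound c₂ cd (sharedIndices i j).card * crossingProbability L r μ := by
  by_cases hij : (sharedIndices i j).Nonempty
  · rw [covariance_eq_sub (memLp_crossingIndicator L r i _) (memLp_crossingIndicator L r j _)]
    have h0 : 0 ≤ (∫ x, crossingIndicator L r i x ∂Measure.pi (fun _ : ι => μ)) *
        ∫ x, crossingIndicator L r j x ∂Measure.pi (fun _ : ι => μ) :=
      mul_nonneg (integral_nonneg (crossingIndicator_nonneg L r i))
        (integral_nonneg (crossingIndicator_nonneg L r j))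
    -- The product of the means is nonnegative and is discarded; only the joint crossing probability
    -- remains.
    refine (sub_le_self _ h0).trans ?_
    have hmul : crossingIndicator L r i * crossingIndicator L r j =
        ({x : ι → E d | x ∘ i ∈ crossingTuples L r} ∩
          {x | x ∘ j ∈ crossingTuples L r}).indicator 1 := by
      unfold crossingIndicator
      rw [Set.inter_indicator_one]
    rw [hmul, integral_indicator_one ((measurableSet_preimage_crossingTuples L r i).inter
      (measurableSet_preimage_crossingTuples L r j)), Measure.real]
    refine ENNReal.toReal_le_of_le_ofReal (mul_nonneg (overlapBound_nonneg hc₂ hcd _)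
      measureReal_nonneg) ?_
    refine (measure_inter_crossingTuples_le h₂ hd hj hij).trans (le_of_eq ?_)
    rw [ENNReal.ofReal_mul (overlapBound_nonneg hc₂ hcd _), ofReal_overlapBound hc₂ hcd,
      measure_crossingTuples L r μ hi, crossingProbability, ofReal_measureReal]
  · rw [covariance_crossingIndicator_of_disjoint L r μ hij]
    exact mul_nonneg (overlapBound_nonneg hc₂ hcd _) measureReal_nonneg

/-- A shared position takes one of at most four values, an unshared one at most `n`. -/
theorem card_filter_subset_sharedIndices_le {n : ℕ} (i : Fin 4 → Fin n) (A : Finset (Fin 4)) :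
    (Finset.univ.filter fun j : Fin 4 → Fin n => sharedIndices i j = A).card ≤
      4 ^ A.card * n ^ (4 - A.card) := by
  calc _ ≤ (Fintype.piFinset fun l : Fin 4 =>
          if l ∈ A then Finset.univ.image i else Finset.univ).card := by
        refine Finset.card_le_card fun j hj => ?_
        rw [Fintype.mem_piFinset]
        intro l
        split_ifs with hl
        · rw [← (Finset.mem_filter.1 hj).2] at hl
          exact (Finset.mem_filter.1 hl).2
        · exact Finset.mem_univ _
    _ = ∏ l : Fin 4, if l ∈ A then (Finset.univ.image i).card else n := by
        rw [Fintype.card_piFinset]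
        refine Finset.prod_congr rfl fun l _ => ?_
        split_ifs <;> simp
    _ = (Finset.univ.image i).card ^ A.card * n ^ (4 - A.card) := by
        rw [Finset.prod_ite, Finset.prod_const, Finset.prod_const, Finset.filter_mem_eq_inter,
          Finset.univ_inter, Finset.filter_notMem_eq_sdiff, Finset.card_univ_sdiff,
          Fintype.card_fin]
    _ ≤ _ := by
        gcongr
        exact Finset.card_image_le.trans (by simp)

/-- The covariances are grouped by the set of shared positions, then by its size `k`, which produces
the binomial coefficients. -/
theorem variance_crossingCount_le {d : ℕ} {L : Submodule ℝ (E d)} {r : ℝ} {μ : Measure (E d)}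
    [IsProbabilityMeasure μ] {c₂ cd : ℝ} (hc₂ : 0 ≤ c₂) (hcd : 0 ≤ cd)
    (h₂ : ∀ a : L,
      μ {y | dist (L.orthogonalProjectionOnto y) a ≤ 2 * r} ≤ ENNReal.ofReal c₂)
    (hd : ∀ a : E d, μ {y | dist y a ≤ r} ≤ ENNReal.ofReal cd) (n : ℕ) :
    Var[crossingCount L r n; Measure.pi fun _ => μ] ≤
      n ^ 4 * ((∑ k ∈ Finset.range 5,
        (Nat.choose 4 k : ℝ) * (4 ^ k * n ^ (4 - k) * overlapBound c₂ cd k)) *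
          crossingProbability L r μ) := by
  have hp : 0 ≤ crossingProbability L r μ := measureReal_nonneg
  have hob := overlapBound_nonneg hc₂ hcd
  have hi : ∀ i : Fin 4 → Fin n, ∑ j : Fin 4 → Fin n, overlapBound c₂ cd (sharedIndices i j).card ≤
      ∑ k ∈ Finset.range 5,
        (Nat.choose 4 k : ℝ) * (4 ^ k * n ^ (4 - k) * overlapBound c₂ cd k) := by
    intro i
    calc ∑ j : Fin 4 → Fin n, overlapBound c₂ cd (sharedIndices i j).card
        = ∑ A : Finset (Fin 4), ∑ j ∈ Finset.univ.filter
            (fun j : Fin 4 → Fin n => sharedIndices i j = A),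
              overlapBound c₂ cd (sharedIndices i j).card :=
          (Finset.sum_fiberwise _ _ _).symm
      _ ≤ ∑ A : Finset (Fin 4), (4 ^ A.card * n ^ (4 - A.card) : ℝ) * overlapBound c₂ cd A.card := by
          refine Finset.sum_le_sum fun A _ => ?_
          rw [Finset.sum_congr rfl fun j hj => by rw [(Finset.mem_filter.1 hj).2],
            Finset.sum_const, nsmul_eq_mul]
          refine mul_le_mul_of_nonneg_right ?_ (hob _)
          exact_mod_cast card_filter_subset_sharedIndices_le i A
      _ = _ := by
          rw [← Finset.powerset_univ, Finset.sum_powerset_apply_card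
            (fun k => (4 ^ k * n ^ (4 - k) : ℝ) * overlapBound c₂ cd k)]
          simp [nsmul_eq_mul]
  have hvar : Var[crossingCount L r n; Measure.pi fun _ => μ] =
      ∑ i ∈ injectiveTuples n, ∑ j ∈ injectiveTuples n,
        cov[crossingIndicator L r i, crossingIndicator L r j; Measure.pi fun _ => μ] :=
    variance_fun_sum' fun i _ => memLp_crossingIndicator L r i _
  rw [hvar]
  calc _ ≤ ∑ i ∈ injectiveTuples n, ∑ j ∈ injectiveTuples n,
          overlapBound c₂ cd (sharedIndices i j).card * crossingProbability L r μ :=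
        Finset.sum_le_sum fun i hi => Finset.sum_le_sum fun j hj =>
          covariance_crossingIndicator_le hc₂ hcd h₂ hd (Finset.mem_filter.1 hi).2
            (Finset.mem_filter.1 hj).2
    _ ≤ ∑ i ∈ injectiveTuples n, (∑ k ∈ Finset.range 5,
          (Nat.choose 4 k : ℝ) * (4 ^ k * n ^ (4 - k) * overlapBound c₂ cd k)) *
            crossingProbability L r μ := by
        refine Finset.sum_le_sum fun i _ => ?_
        rw [← Finset.sum_mul]
        refine mul_le_mul_of_nonneg_right (le_trans ?_ (hi i)) hp
        exact Finset.sum_le_sum_of_subset_of_nonneg (Finset.subset_univ _) fun _ _ _ => hob _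
    _ ≤ _ := by
        rw [Finset.sum_const, nsmul_eq_mul]
        refine mul_le_mul_of_nonneg_right ?_ (mul_nonneg (Finset.sum_nonneg fun k _ => ?_) hp)
        · exact_mod_cast card_injectiveTuples_le n
        · have := hob k
          positivity

/-- For distinct points, the crossing number counts the quadruples of indices. -/
theorem projectedCrossingNumber_vertexSet {d : ℕ} (L : Submodule ℝ (E d)) (r : ℝ) {n : ℕ}
    {x : ℕ → E d} (hx : Function.Injective fun k : Fin n => x k) :
    projectedCrossingNumber L r (vertexSet n x) =
      (1 / 8) * crossingCount L r n (fun k => x k) := by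
  classical
  unfold projectedCrossingNumber crossingCount
  congr 1
  symm
  refine Finset.sum_nbij (fun i l => x (i l)) ?_ ?_ ?_ ?_
  · intro i hi
    have hi' : Function.Injective i := (Finset.mem_filter.1 hi).2
    simp only [distinctTuples, Finset.mem_filter, Fintype.mem_piFinset, vertexSet,
      Finset.mem_image, Finset.mem_range]
    exact ⟨fun l => ⟨i l, (i l).2, rfl⟩, hx.comp hi'⟩
  · intro i _ j _ hij
    funext l
    exact hx (congrFun hij l)
  · intro v hv
    simp only [distinctTuples, Finset.coe_filter, Fintype.mem_piFinset, vertexSet,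
      Finset.mem_image, Finset.mem_range, Set.mem_ofPred_eq] at hv
    obtain ⟨hv, hinj⟩ := hv
    choose i hin hiv using hv
    refine ⟨fun l => ⟨i l, hin l⟩, ?_, funext hiv⟩
    simp only [injectiveTuples, Finset.coe_filter, Finset.mem_univ, true_and, Set.mem_ofPred_eq]
    intro l m hlm
    refine hinj ?_
    rw [← hiv, ← hiv]
    exact congrArg x (Fin.mk.inj_iff.1 hlm)
  · intro i _
    simp only [edgeSegment_image_inter_nonempty_iff, crossingIndicator, Set.indicator_apply]
    rfl

/-! ### Concentration of the Poisson distribution -/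

/-- The variance comes from the factorial moments of `n` and `n (n - 1)`, obtained by shifting the
series by one and by two. -/
theorem hasSum_poissonMeasure_sub_sq (r : NNReal) :
    HasSum (fun n : ℕ => Real.exp (-r) * (r : ℝ) ^ n / n.factorial * ((n : ℝ) - r) ^ 2) r := by
  have h0 := hasSum_one_poissonMeasure r
  have h1 : HasSum (fun n : ℕ => Real.exp (-r) * (r : ℝ) ^ n / n.factorial * n) r := by
    rw [← hasSum_nat_add_iff' 1]
    convert! h0.mul_left (r : ℝ) using 1
    · ext n
      have : (n.factorial : ℝ) ≠ 0 := by positivity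
      rw [Nat.factorial_succ]
      push_cast
      field_simp
      ring
    · simp
  have h2 : HasSum (fun n : ℕ => Real.exp (-r) * (r : ℝ) ^ n / n.factorial * (n * (n - 1)))
      ((r : ℝ) ^ 2) := by
    rw [← hasSum_nat_add_iff' 2]
    convert! h0.mul_left ((r : ℝ) ^ 2) using 1
    · ext n
      have : (n.factorial : ℝ) ≠ 0 := by positivity
      rw [Nat.factorial_succ, Nat.factorial_succ]
      push_cast
      field_simp
      ring
    · simp [Finset.sum_range_succ]
  convert! (h2.add (h1.mul_left (1 - 2 * (r : ℝ)))).add (h0.mul_left ((r : ℝ) ^ 2)) using 1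
  · ext n
    ring
  · ring

theorem poissonMeasure_abs_sub_ge_le (r : NNReal) {c : ℝ} (hc : 0 < c) :
    poissonMeasure r {n | c ≤ |(n : ℝ) - r|} ≤ ENNReal.ofReal (r / c ^ 2) := by
  have hs := hasSum_poissonMeasure_sub_sq r
  have hint : Integrable (fun n : ℕ => ((n : ℝ) - r) ^ 2) (poissonMeasure r) := by
    rw [integrable_poissonMeasure_iff]
    refine hs.summable.congr fun n => ?_
    rw [Real.norm_eq_abs, abs_of_nonneg (sq_nonneg _)]
  have hval : ∫ n, ((n : ℝ) - r) ^ 2 ∂poissonMeasure r = r := by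
    rw [integral_poissonMeasure' hint]
    simpa only [smul_eq_mul] using hs.tsum_eq
  have h := mul_meas_ge_le_integral_of_nonneg (ae_of_all _ fun n : ℕ => sq_nonneg ((n : ℝ) - r))
    hint (c ^ 2)
  rw [hval] at h
  have hset : {n : ℕ | c ^ 2 ≤ ((n : ℝ) - r) ^ 2} = {n : ℕ | c ≤ |(n : ℝ) - r|} := by
    ext n
    simp only [Set.mem_ofPred_eq]
    rw [sq_le_sq, abs_of_pos hc]
  rw [hset] at h
  rw [ENNReal.le_ofReal_iff_toReal_le (measure_ne_top _ _) (by positivity), le_div_iff₀ (by positivity),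
    mul_comm]
  exact h

/-! ### Properties of the Poisson sample -/

section Sample

variable {d : ℕ} {Ω : Type*} [MeasurableSpace Ω] {P : Measure Ω} {W : Set (E d)} {t : ℝ}
  {N : Ω → ℕ} {X : ℕ → Ω → E d}

theorem IsPoissonSample.measure_count_sub_ge_le (h : IsPoissonSample P W t N X) (ht : 0 ≤ t)
    {c : ℝ} (hc : 0 < c) : P {ω | c ≤ |(N ω : ℝ) - t|} ≤ ENNReal.ofReal (t / c ^ 2) := by
  have := poissonMeasure_abs_sub_ge_le t.toNNReal hc
  rw [← h.hasLaw_count.map_eq,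
    Measure.map_apply_of_aemeasurable h.hasLaw_count.aemeasurable .of_discrete,
    Real.coe_toNNReal t ht] at this
  exact this

theorem IsPoissonSample.map_points [IsProbabilityMeasure P] (h : IsPoissonSample P W t N X)
    (n : ℕ) :
    P.map (fun ω (k : Fin n) => X k ω) = Measure.pi fun _ => (volume.restrict W : Measure (E d)) := by
  have hind : iIndepFun (fun k : Fin n => X k) P := h.indep_points.precomp Fin.val_injective
  rw [hind.map_fun_eq_pi_map fun k : Fin n => (h.hasLaw_point k).aemeasurable]
  congr 1
  funext k
  exact (h.hasLaw_point k).map_eq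

theorem IsPoissonSample.ae_injective [IsProbabilityMeasure P] (h : IsPoissonSample P W t N X)
    (hd : d ≠ 0) : ∀ᵐ ω ∂P, Function.Injective fun k => X k ω := by
  have : Nontrivial (E d) := by
    have : Nonempty (Fin d) := ⟨⟨0, Nat.pos_of_ne_zero hd⟩⟩
    infer_instance
  have hne : ∀ i j : ℕ, i ≠ j → ∀ᵐ ω ∂P, X i ω ≠ X j ω := by
    intro i j hij
    have hi := (h.hasLaw_point i).aemeasurable
    have hj := (h.hasLaw_point j).aemeasurable
    have hmap := (indepFun_iff_map_prod_eq_prod_map_map hi hj).1 (h.indep_points.indepFun hij)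
    rw [(h.hasLaw_point i).map_eq, (h.hasLaw_point j).map_eq] at hmap
    have hdiag : MeasurableSet {q : E d × E d | q.1 = q.2} :=
      (isClosed_eq continuous_fst continuous_snd).measurableSet
    have hnull : ((volume.restrict W).prod (volume.restrict W)) {q : E d × E d | q.1 = q.2} = 0 := by
      rw [Measure.measure_prod_null hdiag]
      refine ae_of_all _ fun x => ?_
      have : Prod.mk x ⁻¹' {q : E d × E d | q.1 = q.2} = {x} := by
        ext y
        simp [eq_comm]
      change (volume.restrict W) (Prod.mk x ⁻¹' {q : E d × E d | q.1 = q.2}) = 0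
      rw [this]
      exact measure_singleton x
    rw [← hmap, Measure.map_apply_of_aemeasurable (hi.prodMk hj) hdiag] at hnull
    exact measure_eq_zero_iff_ae_notMem.1 hnull
  have : ∀ᵐ ω ∂P, ∀ i j : ℕ, i ≠ j → X i ω ≠ X j ω :=
    ae_all_iff.2 fun i => ae_all_iff.2 fun j => by
      by_cases hij : i = j
      · simp [hij]
      · filter_upwards [hne i j hij] with ω hω _ using hω
  filter_upwards [this] with ω hω i j hij
  by_contra hne
  exact hω i j hne hij

/-- A property of the points that is unlikely for each of finitely many values of their number is
unlikely. -/
theorem IsPoissonSample.measure_points_mem_le [IsProbabilityMeasure P]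
    (h : IsPoissonSample P W t N X) (F : Finset ℕ) {T : ∀ n : ℕ, Set (Fin n → E d)}
    (hT : ∀ n, MeasurableSet (T n)) {b : ENNReal}
    (hb : ∀ n ∈ F, Measure.pi (fun _ => (volume.restrict W : Measure (E d))) (T n) ≤ b) :
    P {ω | N ω ∈ F ∧ (fun k : Fin (N ω) => X k ω) ∈ T (N ω)} ≤ b := by
  have hN := h.hasLaw_count.aemeasurable
  have hXn : ∀ n : ℕ, AEMeasurable (fun ω (k : Fin n) => X k ω) P := fun n =>
    aemeasurable_pi_lambda _ fun k => (h.hasLaw_point k).aemeasurable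
  calc P {ω | N ω ∈ F ∧ (fun k : Fin (N ω) => X k ω) ∈ T (N ω)}
      ≤ P (⋃ n ∈ F, N ⁻¹' {n} ∩ (fun ω i => X i ω) ⁻¹' ((fun x (k : Fin n) => x k) ⁻¹' T n)) := by
        refine measure_mono fun ω hω => ?_
        simp only [Set.mem_iUnion]
        exact ⟨N ω, hω.1, rfl, hω.2⟩
    _ ≤ ∑ n ∈ F, P (N ⁻¹' {n} ∩
          (fun ω i => X i ω) ⁻¹' ((fun x (k : Fin n) => x k) ⁻¹' T n)) :=
        measure_biUnion_finset_le _ _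
    -- Independence of `N` and the points keeps the weight `P (N = n)` in each term. The weights sum
    -- to at most `1`, so the union bound does not cost a factor `F.card`.
    _ ≤ ∑ n ∈ F, P (N ⁻¹' {n}) * b := by
        refine Finset.sum_le_sum fun n hn => ?_
        rw [h.indep_count.measure_inter_preimage_eq_mul _ _ .of_discrete
          ((measurable_pi_lambda _ fun k => measurable_pi_apply _) (hT n))]
        gcongr
        refine le_trans (le_of_eq ?_) (hb n hn)
        rw [← h.map_points n, Measure.map_apply_of_aemeasurable (hXn n) (hT n)]
        rfl
    _ = P.map N F * b := by
        rw [← Finset.sum_mul, ← sum_measure_singleton]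
        congr 1
        refine Finset.sum_congr rfl fun n _ => ?_
        rw [Measure.map_apply_of_aemeasurable hN .of_discrete]
    _ ≤ 1 * b := by
        gcongr
        rw [h.hasLaw_count.map_eq]
        exact prob_le_one
    _ = b := one_mul b

end Sample

/-! ### The law of large numbers -/

/-- Here `q` stands for `r ^ d` and `s` for `r ^ 2`. The term `k = 1` already has order `t³ q² s`;
for larger `k`, the missing powers of `t` and `q` are supplied by factors `t * q / c ≥ 1`, together
with `q ≤ s`. Each coefficient is `choose 4 k * 4 ^ k` times the constant of the matching bound
`e1`, …, `e4`. -/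
theorem sum_overlapBound_le {a C c q s t n : ℝ} (ha : 0 ≤ a) (hC : 0 ≤ C) (hc : 0 < c)
    (hq : 0 < q) (hqs : q ≤ s) (ht : 0 < t) (hcq : c ≤ t * q) (hn0 : 0 ≤ n) (hn : n ≤ 2 * t) :
    ∑ k ∈ Finset.range 5,
        (Nat.choose 4 k : ℝ) * (4 ^ k * n ^ (4 - k) * overlapBound (C * s) (a * q) k) ≤
      (128 * a ^ 2 * C + 384 * a * C / c + 512 * a / c ^ 2 + 256 / c ^ 3) *
        (t ^ 3 * (q ^ 2 * s)) := by
  have hs : 0 < s := hq.trans_le hqs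
  have hu : 1 ≤ t * q / c := (one_le_div hc).2 hcq
  have hu2 : 1 ≤ (t * q / c) ^ 2 := one_le_pow₀ hu
  have hu3 : 1 ≤ (t * q / c) ^ 3 := one_le_pow₀ hu
  have hn2 : n ^ 2 ≤ (2 * t) ^ 2 := pow_le_pow_left₀ hn0 hn 2
  have hn3 : n ^ 3 ≤ (2 * t) ^ 3 := pow_le_pow_left₀ hn0 hn 3
  have e1 : n ^ 3 * (a * q * (C * s * (a * q))) ≤ 8 * a ^ 2 * C * (t ^ 3 * (q ^ 2 * s)) := by
    calc _ ≤ (2 * t) ^ 3 * (a * q * (C * s * (a * q))) := by gcongr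
      _ = _ := by ring
  have e2 : n ^ 2 * (a * q * (C * s)) ≤ 4 * a * C / c * (t ^ 3 * (q ^ 2 * s)) := by
    calc _ ≤ (2 * t) ^ 2 * (a * q * (C * s)) * 1 := by rw [mul_one]; gcongr
      _ ≤ (2 * t) ^ 2 * (a * q * (C * s)) * (t * q / c) := by gcongr
      _ = _ := by ring
  have e3 : n * (a * q) ≤ 2 * a / c ^ 2 * (t ^ 3 * (q ^ 2 * s)) := by
    calc _ ≤ (2 * t) * (a * q) * 1 := by rw [mul_one]; gcongr
      _ ≤ (2 * t) * (a * q) * (t * q / c) ^ 2 := by gcongr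
      _ = 2 * a / c ^ 2 * (t ^ 3 * (q ^ 2 * q)) := by ring
      _ ≤ _ := by gcongr
  have e4 : (1 : ℝ) ≤ 1 / c ^ 3 * (t ^ 3 * (q ^ 2 * s)) := by
    calc _ ≤ (t * q / c) ^ 3 := hu3
      _ = 1 / c ^ 3 * (t ^ 3 * (q ^ 2 * q)) := by ring
      _ ≤ _ := by gcongr
  have h42 : Nat.choose 4 2 = 6 := rfl
  have h43 : Nat.choose 4 3 = 4 := rfl
  simp only [Finset.sum_range_succ, Finset.sum_range_zero, overlapBound, h42, h43, Nat.choose_zero_right,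
    Nat.choose_one_right, Nat.choose_self]
  norm_num
  calc _ ≤ 16 * (8 * a ^ 2 * C * (t ^ 3 * (q ^ 2 * s))) +
        96 * (4 * a * C / c * (t ^ 3 * (q ^ 2 * s))) +
        256 * (2 * a / c ^ 2 * (t ^ 3 * (q ^ 2 * s))) +
        256 * (1 / c ^ 3 * (t ^ 3 * (q ^ 2 * s))) := by linarith
    _ = _ := by ring

theorem cast_descFactorial_four (n : ℕ) :
    (n.descFactorial 4 : ℝ) = n * (n - 1) * (n - 2) * (n - 3) := by
  match n with
  | 0 => simp [Nat.descFactorial]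
  | 1 => simp [Nat.descFactorial]
  | 2 => simp [Nat.descFactorial]
  | n + 3 =>
    simp only [Nat.descFactorial]
    have h1 : n + 3 - 3 = n := by omega
    have h2 : n + 3 - 2 = n + 1 := by omega
    have h3 : n + 3 - 1 = n + 2 := by omega
    rw [h1, h2, h3]
    push_cast
    simp
    ring

/-- The expected numbers of crossings are asymptotically `ℓ t⁴ D`. -/
theorem exists_abs_descFactorial_mul_div_sub_lt {p D : ℝ → ℝ} {ℓ : ℝ}
    (hp : Tendsto (fun t => p t / D t) atTop (𝓝 ℓ)) {ε : ℝ} (hε : 0 < ε) :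
    ∃ η : ℝ, 0 < η ∧ ∀ᶠ t in atTop, ∀ n : ℕ, |(n : ℝ) - t| < η * t →
      |n.descFactorial 4 * p t / (t ^ 4 * D t) - ℓ| < ε := by
  -- The normalised mean is this polynomial at `(n / t, 1 / t, p t / D t)`. Continuity at `(1, 0,
  -- ℓ)` makes the estimate uniform in `n`.
  let f : ℝ × ℝ × ℝ → ℝ := fun q =>
    q.1 * (q.1 - q.2.1) * (q.1 - 2 * q.2.1) * (q.1 - 3 * q.2.1) * q.2.2
  have hf : ContinuousAt f (1, 0, ℓ) := Continuous.continuousAt (by fun_prop)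
  obtain ⟨η, hη, hfη⟩ := Metric.continuousAt_iff.1 hf ε hε
  refine ⟨η, hη, ?_⟩
  have h1 : ∀ᶠ t in atTop, dist (p t / D t) ℓ < η := Metric.tendsto_nhds.1 hp η hη
  have h2 : ∀ᶠ t : ℝ in atTop, dist t⁻¹ 0 < η := Metric.tendsto_nhds.1 tendsto_inv_atTop_zero η hη
  filter_upwards [h1, h2, eventually_gt_atTop 0] with t ht1 ht2 ht n hn
  have hdist : dist ((n : ℝ) / t, t⁻¹, p t / D t) (1, 0, ℓ) < η := by
    rw [Prod.dist_eq, Prod.dist_eq]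
    refine max_lt ?_ (max_lt ht2 ht1)
    rw [Real.dist_eq]
    have : (n : ℝ) / t - 1 = (n - t) / t := by field_simp
    rw [this, abs_div, abs_of_pos ht, div_lt_iff₀ ht]
    exact hn
  have := hfη hdist
  rw [Real.dist_eq] at this
  convert this using 3
  · simp only [f]
    rw [cast_descFactorial_four, mul_div_mul_comm]
    congr 1
    field_simp
  · simp [f]

theorem tendsto_crossingProbability_div {d : ℕ} (hd : 2 ≤ d) {W : Set (E d)}
    (hb : Bornology.IsBounded W) (hfr : volume (frontier W) = 0)
    {L : Submodule ℝ (E d)} (hL : Module.finrank ℝ L = 2) :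
    Tendsto (fun r : ℝ => crossingProbability L r (volume.restrict W) / r ^ (2 * d + 2))
      (𝓝[>] 0) (𝓝 (crossingConstant d * secondSectionIntegral W L)) := by
  have hfr' : volume (frontier (interior W)) = 0 :=
    measure_mono_null frontier_interior_subset hfr
  have hμ : (volume : Measure (E d)).restrict (interior W) = volume.restrict W :=
    Measure.restrict_congr_set (interior_ae_eq_of_null_frontier hfr)
  have h := tendsto_measure_crossingEvent L hL isOpen_interior (hb.subset interior_subset) hfr'
  rw [hμ, ← ofReal_crossingConstant hd hL] at h
  have hfin := lintegral_sectionVolume_sq_lt_top L (hb.subset (interior_subset (s := W)))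
  have h' := (ENNReal.tendsto_toReal (ENNReal.mul_lt_top ENNReal.ofReal_lt_top hfin).ne).comp h
  rw [ENNReal.toReal_mul, ← secondSectionIntegral_eq_toReal L hb hfr,
    ENNReal.toReal_ofReal (show 0 ≤ crossingConstant d from measureReal_nonneg)] at h'
  refine h'.congr' ?_
  filter_upwards [self_mem_nhdsWithin] with r hr
  have hr : 0 < r := hr
  simp only [Function.comp, ENNReal.toReal_div]
  rw [ENNReal.toReal_ofReal (by positivity)]
  rfl

/-- The variance of the crossing count of at most `2 t` points is of the order `t⁷ r^(4d+4)`. -/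
theorem exists_variance_crossingCount_le {d : ℕ} (hd : 2 ≤ d) {W : Set (E d)}
    (hvol : volume W = 1) (hb : Bornology.IsBounded W) (hfr : volume (frontier W) = 0)
    {L : Submodule ℝ (E d)} (hL : Module.finrank ℝ L = 2) {c : ℝ} (hc : 0 < c) :
    ∃ K r₀ : ℝ, 0 ≤ K ∧ 0 < r₀ ∧ ∀ t r : ℝ, 0 < t → 0 < r → r < r₀ → c ≤ t * r ^ d →
      ∀ n : ℕ, (n : ℝ) ≤ 2 * t →
        Var[crossingCount L r n; Measure.pi fun _ => volume.restrict W] ≤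
          K * t ^ 7 * (r ^ (2 * d + 2)) ^ 2 := by
  have : IsProbabilityMeasure ((volume : Measure (E d)).restrict W) :=
    ⟨by rw [Measure.restrict_apply_univ, hvol]⟩
  obtain ⟨C, hC, hslab⟩ := exists_volume_slab_le L hL hb
  set ℓ := crossingConstant d * secondSectionIntegral W L with hℓ
  have hlim := tendsto_crossingProbability_div hd hb hfr hL
  have hev : ∀ᶠ r in 𝓝[>] (0 : ℝ),
      crossingProbability L r (volume.restrict W) / r ^ (2 * d + 2) < |ℓ| + 1 :=
    hlim.eventually (gt_mem_nhds (lt_of_le_of_lt (le_abs_self ℓ) (lt_add_one _)))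
  obtain ⟨r₁, hr₁, hsub⟩ := mem_nhdsGT_iff_exists_Ioo_subset.1 hev
  set a := (volume (Metric.ball (0 : E d) 1)).toReal with ha
  have ha0 : 0 ≤ a := ENNReal.toReal_nonneg
  set K₁ := 128 * a ^ 2 * (4 * C) + 384 * a * (4 * C) / c + 512 * a / c ^ 2 + 256 / c ^ 3
    with hK₁
  have hK₁0 : 0 ≤ K₁ := by positivity
  -- The factor `16` comes from `n ^ 4 ≤ (2 * t) ^ 4`; `r ≤ 1` is what gives `r ^ d ≤ r ^ 2`.
  refine ⟨16 * K₁ * (|ℓ| + 1), min r₁ 1, by positivity, lt_min hr₁ one_pos, ?_⟩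
  intro t r ht hr hr0 hcr n hn
  have hr1 : r ≤ 1 := (hr0.trans_le (min_le_right _ _)).le
  have hp : crossingProbability L r (volume.restrict W) ≤ (|ℓ| + 1) * r ^ (2 * d + 2) := by
    have h1 : crossingProbability L r (volume.restrict W) / r ^ (2 * d + 2) < |ℓ| + 1 :=
      hsub ⟨hr, hr0.trans_le (min_le_left _ _)⟩
    exact ((div_lt_iff₀ (by positivity)).1 h1).le
  have h₂ : ∀ x : L, (volume.restrict W : Measure (E d))
      {y | dist (L.orthogonalProjectionOnto y) x ≤ 2 * r} ≤ ENNReal.ofReal (4 * C * r ^ 2) := by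
    intro x
    have hm : MeasurableSet {y : E d | dist (L.orthogonalProjectionOnto y) x ≤ 2 * r} :=
      (isClosed_le (by fun_prop) continuous_const).measurableSet
    rw [Measure.restrict_apply hm]
    refine (hslab x (2 * r) (by positivity)).trans (le_of_eq ?_)
    congr 1
    ring
  have hball : ∀ x : E d, (volume.restrict W : Measure (E d)) {y | dist y x ≤ r} ≤
      ENNReal.ofReal (a * r ^ d) := by
    intro x
    refine (Measure.restrict_apply_le _ _).trans (le_of_eq ?_)
    have : {y : E d | dist y x ≤ r} = Metric.closedBall x r := rfl
    rw [this, Measure.addHaar_closedBall _ _ hr.le, finrank_euclideanSpace_fin, mul_comm a,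
      ENNReal.ofReal_mul (by positivity), ha, ENNReal.ofReal_toReal measure_ball_lt_top.ne]
  have hsum := sum_overlapBound_le (a := a) (C := 4 * C) (c := c) (q := r ^ d) (s := r ^ 2)
    (t := t) (n := n) ha0 (by positivity) hc (by positivity)
    (pow_le_pow_of_le_one hr.le hr1 hd) ht hcr (Nat.cast_nonneg n) hn
  have hq : (r ^ d) ^ 2 * r ^ 2 = r ^ (2 * d + 2) := by ring
  rw [hq, ← hK₁] at hsum
  have hn4 : (n : ℝ) ^ 4 ≤ (2 * t) ^ 4 := pow_le_pow_left₀ (Nat.cast_nonneg n) hn 4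
  calc _ ≤ _ := variance_crossingCount_le (by positivity) (by positivity) h₂ hball n
    _ ≤ (2 * t) ^ 4 * (K₁ * (t ^ 3 * r ^ (2 * d + 2)) * ((|ℓ| + 1) * r ^ (2 * d + 2))) := by
        have hpn : 0 ≤ crossingProbability L r (volume.restrict W) := measureReal_nonneg
        refine mul_le_mul hn4 (mul_le_mul hsum hp hpn (by positivity)) ?_ (by positivity)
        refine mul_nonneg (Finset.sum_nonneg fun k _ => ?_) hpn
        have := overlapBound_nonneg (c₂ := 4 * C * r ^ 2) (cd := a * r ^ d)
          (by positivity) (by positivity) k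
        positivity
    _ = _ := by ring

/-- The deviation probability of the rescaled crossing number. -/
theorem IsPoissonSample.measure_crossingNumber_sub_ge_le {d : ℕ} (hd : d ≠ 0) {W : Set (E d)}
    [IsProbabilityMeasure ((volume : Measure (E d)).restrict W)] {L : Submodule ℝ (E d)}
    {Ω : Type*} [MeasurableSpace Ω] {P : Measure Ω} [IsProbabilityMeasure P] {t : ℝ}
    {N : Ω → ℕ} {X : ℕ → Ω → E d} (h : IsPoissonSample P W t N X) {r D ℓ ε η v : ℝ} (ht : 0 < t)
    (hD : 0 < D) (hε : 0 < ε) (hη : 0 < η) (hη1 : η ≤ 1)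
    (hmean : ∀ n : ℕ, |(n : ℝ) - t| < η * t →
      |n.descFactorial 4 * crossingProbability L r (volume.restrict W) / (t ^ 4 * D) - ℓ| < 4 * ε)
    (hvar : ∀ n : ℕ, (n : ℝ) ≤ 2 * t →
      Var[crossingCount L r n; Measure.pi fun _ => volume.restrict W] ≤ v) :
    P {ω | ε ≤ ‖projectedCrossingNumber L r (vertexSet (N ω) fun i => X i ω) / (t ^ 4 * D) -
        1 / 8 * ℓ‖} ≤
      ENNReal.ofReal (t / (η * t) ^ 2) + ENNReal.ofReal (v / (4 * ε * (t ^ 4 * D)) ^ 2) := by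
  have hM : 0 < t ^ 4 * D := by positivity
  have hb : 0 < 4 * ε * (t ^ 4 * D) := by positivity
  -- Fluctuation and bias of the count are each allowed `4 * ε`; the prefactor `1 / 8` turns their
  -- sum into `ε`.
  let T : ∀ n : ℕ, Set (Fin n → E d) := fun n => {x | 4 * ε * (t ^ 4 * D) ≤
    |crossingCount L r n x - n.descFactorial 4 * crossingProbability L r (volume.restrict W)|}
  have hT : ∀ n, MeasurableSet (T n) := fun n =>
    measurableSet_le measurable_const
      ((measurable_crossingCount L r n).sub_const _).abs
  have hTle : ∀ n ∈ Finset.range (⌊2 * t⌋₊ + 1),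
      Measure.pi (fun _ => (volume.restrict W : Measure (E d))) (T n) ≤
        ENNReal.ofReal (v / (4 * ε * (t ^ 4 * D)) ^ 2) := by
    intro n hn
    have hn' : (n : ℝ) ≤ 2 * t :=
      (Nat.le_floor_iff (by positivity)).1 (Nat.lt_succ_iff.1 (Finset.mem_range.1 hn))
    have := meas_ge_le_variance_div_sq
      (memLp_crossingCount L r n (Measure.pi fun _ => volume.restrict W)) hb
    rw [integral_crossingCount] at this
    refine this.trans (ENNReal.ofReal_le_ofReal ?_)
    gcongr
    exact hvar n hn'
  refine le_trans ?_ (add_le_add (h.measure_count_sub_ge_le ht.le (c := η * t) (by positivity))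
    (h.measure_points_mem_le (Finset.range (⌊2 * t⌋₊ + 1)) hT hTle))
  refine le_trans (measure_mono_ae ?_) (measure_union_le _ _)
  -- Coinciding sample points would merge in the vertex set, so the count over indices equals the
  -- crossing number only almost surely.
  filter_upwards [h.ae_injective hd] with ω hω hmem
  have hmem : ε ≤ ‖projectedCrossingNumber L r (vertexSet (N ω) fun i => X i ω) / (t ^ 4 * D) -
    1 / 8 * ℓ‖ := hmem
  by_contra hnot
  have h1 : |(N ω : ℝ) - t| < η * t := by
    by_contra h1
    exact hnot (Or.inl (not_lt.1 h1))
  have hN : (N ω : ℝ) ≤ 2 * t := by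
    have := (abs_lt.1 h1).2
    nlinarith
  have h2 : (fun k : Fin (N ω) => X k ω) ∉ T (N ω) := by
    intro h2
    refine hnot (Or.inr ⟨?_, h2⟩)
    exact Finset.mem_range.2 (Nat.lt_succ_iff.2 ((Nat.le_floor_iff (by positivity)).2 hN))
  simp only [T, Set.mem_ofPred_eq, not_le] at h2
  have h3 := hmean (N ω) h1
  rw [projectedCrossingNumber_vertexSet L r
    (hω.comp Fin.val_injective : Function.Injective fun k : Fin (N ω) => X k ω)] at hmem
  set S := crossingCount L r (N ω) fun k => X k ω
  set m := (N ω).descFactorial 4 * crossingProbability L r (volume.restrict W)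
  have h4 : |S / (t ^ 4 * D) - m / (t ^ 4 * D)| < 4 * ε := by
    rw [← sub_div, abs_div, abs_of_pos hM, div_lt_iff₀ hM]
    exact h2
  rw [Real.norm_eq_abs, show 1 / 8 * S / (t ^ 4 * D) - 1 / 8 * ℓ =
    1 / 8 * ((S / (t ^ 4 * D) - m / (t ^ 4 * D)) + (m / (t ^ 4 * D) - ℓ)) by ring, abs_mul,
    abs_of_pos (by norm_num : (0 : ℝ) < 1 / 8)] at hmem
  linarith [abs_add_le (S / (t ^ 4 * D) - m / (t ^ 4 * D)) (m / (t ^ 4 * D) - ℓ)]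

end RandomGeometricGraph

end

/-! ### Convergence in probability. -/

theorem mainTheorem8 {d : ℕ} (hd : 2 ≤ d)
    (W : Set (RandomGeometricGraph.E d)) (hW : Convex ℝ W) (hvol : volume W = 1)
    (L : Submodule ℝ (RandomGeometricGraph.E d)) (hL : Module.finrank ℝ L = 2)
    (δ : ℝ → ℝ) (hδ_pos : ∀ᶠ t in atTop, 0 < δ t) (hδ_lim : Tendsto δ atTop (𝓝 0))
    (hδ_regime : ∃ c : ℝ, 0 < c ∧ ∀ᶠ t in atTop, c ≤ t * δ t ^ d)
    {Ω : Type*} [MeasurableSpace Ω] (P : Measure Ω) [IsProbabilityMeasure P]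
    (N : ℝ → Ω → ℕ) (X : ℝ → ℕ → Ω → RandomGeometricGraph.E d)
    (hV : ∀ t : ℝ, 0 < t → RandomGeometricGraph.IsPoissonSample P W t (N t) (X t)) :
    TendstoInMeasure P
      (fun (t : ℝ) (ω : Ω) =>
        RandomGeometricGraph.projectedCrossingNumber L (δ t)
            (RandomGeometricGraph.vertexSet (N t ω) (fun i => X t i ω)) /
          (t ^ 4 * δ t ^ (2 * d + 2)))
      atTop
      (fun _ =>
        (1 / 8) * RandomGeometricGraph.crossingConstant d *
          RandomGeometricGraph.secondSectionIntegral W L) := by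
  open RandomGeometricGraph in
  have hμ : IsProbabilityMeasure ((volume : Measure (E d)).restrict W) :=
    ⟨by rw [Measure.restrict_apply_univ, hvol]⟩
  have hb : Bornology.IsBounded W :=
    isBounded_of_convex_of_volume hW (by simp [hvol]) (by simp [hvol])
  have hfr : volume (frontier W) = 0 := hW.addHaar_frontier volume
  have hδ : Tendsto δ atTop (𝓝[>] 0) := tendsto_nhdsWithin_iff.2 ⟨hδ_lim, hδ_pos⟩
  have hp := (tendsto_crossingProbability_div hd hb hfr hL).comp hδ
  obtain ⟨c, hc, hreg⟩ := hδ_regime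
  obtain ⟨K, r₀, hK, hr₀, hvar⟩ := exists_variance_crossingCount_le hd hvol hb hfr hL hc
  rw [tendstoInMeasure_iff_norm]
  intro ε hε
  obtain ⟨η, hη, hmean⟩ := exists_abs_descFactorial_mul_div_sub_lt
    (p := fun t => crossingProbability L (δ t) (volume.restrict W))
    (D := fun t => δ t ^ (2 * d + 2)) hp (ε := 4 * ε) (by positivity)
  -- The cap at `1` ensures that `|n - t| < θ * t` implies `n ≤ 2 * t`, the range of the variance
  -- bound.
  set θ := min η 1 with hθ
  have hθ0 : 0 < θ := lt_min hη one_pos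
  -- The two Chebyshev errors: `t / (θ * t) ^ 2` for the Poisson count, and the variance bound `K *
  -- t ^ 7 * D ^ 2` over `(4 * ε * t ^ 4 * D) ^ 2` for the crossings, with `D = δ t ^ (2 * d + 2)`.
  -- Both have order `1 / t`.
  have hlim : Tendsto (fun t : ℝ => ENNReal.ofReal (1 / θ ^ 2 * t⁻¹) +
      ENNReal.ofReal (K / (4 * ε) ^ 2 * t⁻¹)) atTop (𝓝 0) := by
    have h : ∀ A : ℝ, Tendsto (fun t : ℝ => ENNReal.ofReal (A * t⁻¹)) atTop (𝓝 0) := fun A => by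
      simpa using ENNReal.tendsto_ofReal (tendsto_inv_atTop_zero.const_mul A)
    simpa using (h _).add (h _)
  refine tendsto_of_tendsto_of_tendsto_of_le_of_le' tendsto_const_nhds hlim
    (Eventually.of_forall fun _ => zero_le) ?_
  filter_upwards [hmean, hδ_pos, hreg, hδ_lim.eventually (gt_mem_nhds hr₀), eventually_gt_atTop 0]
    with t hmt hpos hct hrt ht
  have hbound := (hV t ht).measure_crossingNumber_sub_ge_le (L := L) (r := δ t)
    (D := δ t ^ (2 * d + 2)) (ε := ε) (η := θ) (by omega) ht (by positivity) hε hθ0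
    (min_le_right _ _)
    (fun n hn => hmt n (hn.trans_le (by gcongr; exact min_le_left _ _)))
    (hvar t (δ t) ht hpos hrt hct)
  simp only [mul_assoc] at hbound ⊢
  refine hbound.trans (le_of_eq ?_)
  congr 2
  · field_simp
  · field_simp
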